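/- Setting. The scalar field is $\mathbb R$ or $\mathbb C$. Let $(X,\mathcal F,\mu)$ be a probability space, $m\ge 1$, and let $T_1,\dots,T_m$ be measure preserving transformations of $X$ (for instance all equal to one $T$). On $L_p(\mu)$ let $V_l f=f\circ T_l$, and let $V_l^*$ be the adjoint (transfer) operator, i.e. $\int (V_l^*f)\,g\,d\mu=\int f\,(g\circ T_l)\,d\mu$ for $g\in L_{p'}(\mu)$, $1/p+1/p'=1$. Let $L_{p,\pi}(\mu^m)$ be the completed projective tensor product of $m$ copies of $L_p(\mu)$, with norm $|\cdot|_{p,m,\pi}$; its elements are viewed as functions on $X^m$ through the contraction $J_m:L_{p,\pi}(\mu^m)\to L_p(\mu^m)$, $f_1\otimes\cdots\otimes f_m\mapsto f_1(x_1)\cdots f_m(x_m)$. For $\mathbf k\in\mathbb Z_+^m$ put $V^{\mathbf k}=V_1^{k_1}\otimes\cdots\otimes V_m^{k_m}$ and $V^{*\mathbf k}=V_1^{*k_1}\otimes\cdots\otimes V_m^{*k_m}$ on $L_{p,\pi}(\mu^m)$; $\mathbf e_1,\dots,\mathbf e_m$ is the standard basis of $\mathbb Z_+^m$, and $\mathbf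 k<\mathbf n$ means $k_l<n_l$ for all $l$. For $p\ge m$ let $D_m:L_{p,\pi}(\mu^m)\to L_{p/m}(\mu)$ be the continuous linear map with $D_m(f_1\otimes\cdots\otimes f_m)=f_1\cdots f_m$. An element $f$ of $L_{p,\pi}(\mu^m)$ is called canonical if integrating out any one of its $m$ variables gives $0$ almost everywhere. We write $g=\sum_{\mathbf 0\le\mathbf k<\infty}V^{*\mathbf k}f$ if $\sum_{\mathbf 0\le\mathbf k<\mathbf n}V^{*\mathbf k}f\to g$ in $L_{p,\pi}(\mu^m)$ as $n_1,\dots,n_m\to\infty$, and in that case, for $S\subset\{1,\dots,m\}$, $$A^Sf=\prod_{l\notin S}(I-V^{\mathbf e_l}V^{*\mathbf e_l})\prod_{l\in S}(V^{\mathbf e_l}-I)\,h^S,\qquad h^S=\Bigl(\prod_{l\in S}V^{*\mathbf e_l}\Bigr)g .$$ Statement. Let $2\le p<\infty$. (1) For every integer $s\ge1$ there is a constant $C(p,s)>0$ such that for all $m$, all $(X,\mathcal F,\mu)$ and $T_1,\dots,T_m$ as above, every $S\subset\{1,\dots,m\}$ with $|S|=s$, every $f\in L_{p,\pi}(\mu^m)$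 with $V^{*\mathbf e_l}f=0$ for all $l\in S$, and all natural numbers $(n_l)_{l\in S}$, $$\Bigl|\sum_{\mathbf k}V^{\mathbf k}f\Bigr|_{p,m,\pi}\le C(p,s)\Bigl(\prod_{l\in S}\sqrt{n_l}\Bigr)|f|_{p,m,\pi},$$ where the sum is over $\mathbf k\in\mathbb Z_+^m$ with $0\le k_l<n_l$ for $l\in S$ and $k_l=0$ for $l\notin S$. If moreover $p\ge m$, then $\bigl|\sum_{\mathbf k}D_mV^{\mathbf k}f\bigr|_{p/m}$ has the same bound. (2) For all $m\ge1$ and $0\le s\le m$ there is a constant $C_{p,m,s}>0$ such that for all $(X,\mathcal F,\mu)$ and $T_1,\dots,T_m$, every canonical $f\in L_{p,\pi}(\mu^m)$ for which $g=\sum_{\mathbf 0\le\mathbf k<\infty}V^{*\mathbf k}f$ converges in $L_{p,\pi}(\mu^m)$, every $S\subset\{1,\dots,m\}$ with $|S|=s$ and all $n_1,\dots,n_m$, $$\Bigl|\sum_{\mathbf 0\le\mathbf k<\mathbf n}V^{\mathbf k}A^Sf\Bigr|_{p,m,\pi}\le C_{p,m,s}\Bigl(\prod_{l\notin S}\sqrt{n_l}\Bigr)|g|_{p,m,\pi},$$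 and, if $p\ge m$, $\bigl|\sum_{\mathbf 0\le\mathbf k<\mathbf n}D_mV^{\mathbf k}A^Sf\bigr|_{p/m}$ has the same bound. (3) For every $m\ge1$ there is a constant $C_{p,m}>0$ such that for all $(X,\mathcal F,\mu)$, $T_1,\dots,T_m$, $f$ and $g$ as in (2) and all $n_1,\dots,n_m$, $$\Bigl|\sum_{\mathbf 0\le\mathbf k<\mathbf n}V^{\mathbf k}f\Bigr|_{p,m,\pi}\le C_{p,m}\sqrt{n_1\cdots n_m}\,|g|_{p,m,\pi},\qquad \Bigl|\sum_{\mathbf 0\le\mathbf k<\mathbf n}V^{*\mathbf k}f\Bigr|_{p,m,\pi}\le C_{p,m}\sqrt{n_1\cdots n_m}\,|g|_{p,m,\pi},$$ and, if $p\ge m$, both $\bigl|\sum_{\mathbf 0\le\mathbf k<\mathbf n}D_mV^{\mathbf k}f\bigr|_{p/m}$ and $\bigl|\sum_{\mathbf 0\le\mathbf k<\mathbf n}D_mV^{*\mathbf k}f\bigr|_{p/m}$ are at most $C_{p,m}\sqrt{n_1\cdots n_m}\,|g|_{p,m,\pi}$. -/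

import Mathlib

open MeasureTheory Filter Topology
open scoped ENNReal TensorProduct

universe u

set_option linter.unusedSectionVars false

noncomputable section

namespace VonMises

variable {𝕜 : Type*} [RCLike 𝕜] {X : Type u} [MeasurableSpace X] {μ : Measure X}
  [IsProbabilityMeasure μ] {p : ℝ≥0∞} [Fact (1 ≤ p)] {m : ℕ}

/-! ### The Koopman operator and its adjoint on `L_p(μ)` -/

/-- The isometry `V f = f ∘ T` of `L_p(μ)`. -/
def koopman (𝕜 : Type*) [RCLike 𝕜] (p : ℝ≥0∞) [Fact (1 ≤ p)] {T : X → X}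
    (hT : MeasurePreserving T μ μ) : Lp 𝕜 p μ →L[𝕜] Lp 𝕜 p μ :=
  (Lp.compMeasurePreservingₗᵢ 𝕜 T hT).toContinuousLinearMap

theorem norm_koopman_apply {T : X → X} (hT : MeasurePreserving T μ μ) (f : Lp 𝕜 p μ) :
    ‖koopman 𝕜 p hT f‖ = ‖f‖ :=
  (Lp.compMeasurePreservingₗᵢ 𝕜 T hT).norm_map f

theorem koopman_injective {T : X → X} (hT : MeasurePreserving T μ μ) :
    Function.Injective (koopman 𝕜 p hT) :=
  (Lp.isometry_compMeasurePreserving hT).injective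

theorem coeFn_koopman {T : X → X} (hT : MeasurePreserving T μ μ) (f : Lp 𝕜 p μ) :
    koopman 𝕜 p hT f =ᵐ[μ] f ∘ T :=
  Lp.coeFn_compMeasurePreserving f hT

/-- `E[f | T⁻¹ 𝓕]` lies in the range of `V`. -/
theorem exists_koopman_eq_condExp {T : X → X} (hT : MeasurePreserving T μ μ) (f : Lp 𝕜 p μ) :
    ∃ h : Lp 𝕜 p μ, koopman 𝕜 p hT h =ᵐ[μ] μ[f | MeasurableSpace.comap T inferInstance] := by
  obtain ⟨h, hm, hh⟩ := (stronglyMeasurable_condExp (μ := μ) (f := (f : X → 𝕜))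
    (m := MeasurableSpace.comap T inferInstance)).exists_eq_measurable_comp
  have hmem : MemLp (h ∘ T) p μ := by
    rw [← hh]; exact (Lp.memLp f).condExp Fact.out
  have hmem' : MemLp h p μ := by
    refine ⟨hm.aestronglyMeasurable, ?_⟩
    rw [← eLpNorm_comp_measurePreserving hm.aestronglyMeasurable hT]
    exact hmem.2
  refine ⟨hmem'.toLp h, (coeFn_koopman hT _).trans ?_⟩
  rw [hh]
  exact hT.quasiMeasurePreserving.ae_eq_comp hmem'.coeFn_toLp

/-- The function `V* f`: the unique element of `L_p(μ)` with `V (V* f) = E[f | T⁻¹ 𝓕]`. -/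
def koopmanAdjFun {T : X → X} (hT : MeasurePreserving T μ μ) (f : Lp 𝕜 p μ) : Lp 𝕜 p μ :=
  (exists_koopman_eq_condExp hT f).choose

theorem koopman_koopmanAdjFun {T : X → X} (hT : MeasurePreserving T μ μ) (f : Lp 𝕜 p μ) :
    koopman 𝕜 p hT (koopmanAdjFun hT f) =ᵐ[μ]
      μ[f | MeasurableSpace.comap T inferInstance] :=
  (exists_koopman_eq_condExp hT f).choose_spec

/-- The operator `V*` on `L_p(μ)` (the transfer operator), the adjoint of the Koopman operator
of the conjugate space; see `integral_koopmanAdj_mul` for the duality relation. -/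
def koopmanAdj (𝕜 : Type*) [RCLike 𝕜] (p : ℝ≥0∞) [Fact (1 ≤ p)] {T : X → X}
    (hT : MeasurePreserving T μ μ) : Lp 𝕜 p μ →L[𝕜] Lp 𝕜 p μ :=
  LinearMap.mkContinuous
    { toFun := koopmanAdjFun hT
      map_add' := fun f g => by
        apply koopman_injective hT
        rw [map_add]
        apply Lp.ext
        have hp : (1 : ℝ≥0∞) ≤ p := Fact.out
        have h1 := condExp_congr_ae (m := MeasurableSpace.comap T inferInstance)
          (Lp.coeFn_add f g)
        have h2 := condExp_add ((Lp.memLp f).integrable hp) ((Lp.memLp g).integrable hp)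
          (MeasurableSpace.comap T inferInstance)
        filter_upwards [koopman_koopmanAdjFun hT (f + g), koopman_koopmanAdjFun hT f,
          koopman_koopmanAdjFun hT g, h1, h2,
          Lp.coeFn_add (koopman 𝕜 p hT (koopmanAdjFun hT f))
            (koopman 𝕜 p hT (koopmanAdjFun hT g))] with x e1 e2 e3 e4 e5 e6
        rw [e1, e4, e5, e6, Pi.add_apply, Pi.add_apply, e2, e3]
      map_smul' := fun c f => by
        apply koopman_injective hT
        rw [RingHom.id_apply, map_smul]
        apply Lp.ext
        have h1 := condExp_congr_ae (m := MeasurableSpace.comap T inferInstance)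
          (Lp.coeFn_smul c f)
        have h2 := condExp_smul (μ := μ) c (f : X → 𝕜)
          (MeasurableSpace.comap T inferInstance)
        filter_upwards [koopman_koopmanAdjFun hT (c • f), koopman_koopmanAdjFun hT f, h1, h2,
          Lp.coeFn_smul c (koopman 𝕜 p hT (koopmanAdjFun hT f))] with x e1 e2 e3 e4 e5
        rw [e1, e3, e4, e5, Pi.smul_apply, Pi.smul_apply, e2] }
    1 fun f => by
      have hp : (1 : ℝ≥0∞) ≤ p := Fact.out
      rw [one_mul, LinearMap.coe_mk, AddHom.coe_mk, ← norm_koopman_apply hT, Lp.norm_def,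
        Lp.norm_def, eLpNorm_congr_ae (koopman_koopmanAdjFun hT f)]
      exact ENNReal.toReal_mono (Lp.eLpNorm_ne_top f) (eLpNorm_condExp_le_eLpNorm _ hp)

/-- The relation `∫ (V* f) g dμ = ∫ f (V g) dμ` for `f ∈ L_p`, `g ∈ L_q`, `1/p + 1/q = 1`. -/
theorem integral_koopmanAdj_mul {q : ℝ≥0∞} [Fact (1 ≤ q)] [ENNReal.HolderConjugate p q]
    {T : X → X} (hT : MeasurePreserving T μ μ) (f : Lp 𝕜 p μ) (g : Lp 𝕜 q μ) :
    ∫ x, koopmanAdj 𝕜 p hT f x * g x ∂μ = ∫ x, f x * koopman 𝕜 q hT g x ∂μ := by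
  have hp : (1 : ℝ≥0∞) ≤ p := Fact.out
  have hq : (1 : ℝ≥0∞) ≤ q := Fact.out
  have hint : Integrable (fun x => f x * koopman 𝕜 q hT g x) μ :=
    memLp_one_iff_integrable.1 ((Lp.memLp (koopman 𝕜 q hT g)).mul (Lp.memLp f))
  have hmeas : AEStronglyMeasurable[MeasurableSpace.comap T inferInstance]
      (koopman 𝕜 q hT g) μ := by
    refine AEStronglyMeasurable.congr ?_ (coeFn_koopman hT g).symm
    refine AEStronglyMeasurable.comp_ae_measurable' ?_ hT.measurable.aemeasurable
    rw [hT.map_eq]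
    exact Lp.aestronglyMeasurable g
  have hpull := condExp_bilin_of_aestronglyMeasurable_right (ContinuousLinearMap.mul ℝ 𝕜) hmeas
    (by simpa using hint) ((Lp.memLp f).integrable hp)
  have h1 : ∫ x, koopmanAdj 𝕜 p hT f x * g x ∂μ
      = ∫ x, koopmanAdj 𝕜 p hT f (T x) * g (T x) ∂μ := by
    have hsm : AEStronglyMeasurable (fun x => koopmanAdj 𝕜 p hT f x * g x) (μ.map T) := by
      rw [hT.map_eq]
      exact (Lp.aestronglyMeasurable _).mul (Lp.aestronglyMeasurable _)
    have := integral_map hT.measurable.aemeasurable hsm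
    rwa [hT.map_eq] at this
  rw [h1, ← integral_condExp hT.measurable.comap_le (f := fun x => f x * koopman 𝕜 q hT g x)]
  refine integral_congr_ae ?_
  filter_upwards [hpull, koopman_koopmanAdjFun hT f, coeFn_koopman hT (koopmanAdjFun hT f),
    coeFn_koopman hT g] with x e1 e2 e3 e4
  have e5 : (μ[fun x => f x * koopman 𝕜 q hT g x | MeasurableSpace.comap T inferInstance]) x
      = (μ[f | MeasurableSpace.comap T inferInstance]) x * koopman 𝕜 q hT g x := by
    simpa using e1
  rw [e5, ← e2, e3, e4]
  rfl

/-! ### The projective tensor power `L_{p,π}(μ^m)` -/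

/-- `L_{p,π}(μ^m)`: the completion of the algebraic tensor power `L_p(μ) ⊗ ⋯ ⊗ L_p(μ)`
(`m` factors) with respect to the projective norm. -/
abbrev ProjLp (𝕜 : Type*) [RCLike 𝕜] (p : ℝ≥0∞) [Fact (1 ≤ p)] (μ : Measure X) (m : ℕ) :=
  UniformSpace.Completion (⨂[𝕜] _ : Fin m, Lp 𝕜 p μ)

/-- The projective tensor product `B₁ ⊗_π ⋯ ⊗_π B_m` of operators on `L_p(μ)`. Operators acting
on different coordinates commute, and this is the product over `l` of the operators which act as
`B_l` on the `l`-th coordinate. -/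
def tensorOp (B : Fin m → (Lp 𝕜 p μ →L[𝕜] Lp 𝕜 p μ)) : ProjLp 𝕜 p μ m →L[𝕜] ProjLp 𝕜 p μ m :=
  (PiTensorProduct.mapL B).completion

/-- `V^k = V₁^{k₁} ⊗_π ⋯ ⊗_π V_m^{k_m}`. -/
def koopmanPow {T : Fin m → X → X} (hT : ∀ l, MeasurePreserving (T l) μ μ) (k : Fin m → ℕ) :
    ProjLp 𝕜 p μ m →L[𝕜] ProjLp 𝕜 p μ m :=
  tensorOp fun l => koopman 𝕜 p (hT l) ^ k l

/-- `V^{*k} = V₁^{*k₁} ⊗_π ⋯ ⊗_π V_m^{*k_m}`. -/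
def koopmanAdjPow {T : Fin m → X → X} (hT : ∀ l, MeasurePreserving (T l) μ μ) (k : Fin m → ℕ) :
    ProjLp 𝕜 p μ m →L[𝕜] ProjLp 𝕜 p μ m :=
  tensorOp fun l => koopmanAdj 𝕜 p (hT l) ^ k l

/-! ### The embedding `J_m` into `L_p(μ^m)` -/

theorem enorm_finset_prod {ι : Type*} (s : Finset ι) (a : ι → 𝕜) :
    ‖∏ l ∈ s, a l‖ₑ = ∏ l ∈ s, ‖a l‖ₑ := by
  simp only [enorm_eq_nnnorm, nnnorm_prod]
  exact map_prod ENNReal.ofNNRealHom _ _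

theorem eLpNorm_pi_prod_le (f : Fin m → Lp 𝕜 p μ) :
    eLpNorm (fun x : Fin m → X => ∏ l, f l (x l)) p (Measure.pi fun _ => μ)
      ≤ ∏ l, eLpNorm (f l) p μ := by
  have hev : ∀ l, MeasurePreserving (Function.eval l) (Measure.pi fun _ : Fin m => μ) μ :=
    fun l => measurePreserving_eval (fun _ : Fin m => μ) l
  have hp0 : p ≠ 0 := (zero_lt_one.trans_le (Fact.out : (1 : ℝ≥0∞) ≤ p)).ne'
  by_cases hpt : p = ∞
  · subst hpt
    simp only [eLpNorm_exponent_top]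
    refine eLpNormEssSup_le_of_ae_enorm_bound ?_
    have h : ∀ l, ∀ᵐ x ∂(Measure.pi fun _ : Fin m => μ),
        ‖f l (x l)‖ₑ ≤ eLpNormEssSup (f l) μ := fun l =>
      (hev l).quasiMeasurePreserving.ae (enorm_ae_le_eLpNormEssSup (f l) μ)
    filter_upwards [ae_all_iff.2 h] with x hx
    rw [enorm_finset_prod]
    exact Finset.prod_le_prod' fun l _ => hx l
  · have hpr : p.toReal ≠ 0 := (ENNReal.toReal_pos hp0 hpt).ne'
    have hmeas : ∀ l, Measurable fun t : X => ‖f l t‖ₑ ^ p.toReal := fun l =>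
      ((Lp.stronglyMeasurable (f l)).enorm).pow_const _
    have key : ∫⁻ x : Fin m → X, ∏ l, ‖f l (x l)‖ₑ ^ p.toReal ∂(Measure.pi fun _ => μ)
        = ∏ l, ∫⁻ t, ‖f l t‖ₑ ^ p.toReal ∂μ := by
      rw [ProbabilityTheory.lintegral_prod_eq_prod_lintegral_of_indepFun Finset.univ
        (fun l (x : Fin m → X) => ‖f l (x l)‖ₑ ^ p.toReal)
        (ProbabilityTheory.iIndepFun_pi (X := fun l t => ‖f l t‖ₑ ^ p.toReal)
          fun l => (hmeas l).aemeasurable)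
        fun l => (hmeas l).comp (measurable_pi_apply l)]
      refine Finset.prod_congr rfl fun l _ => ?_
      exact (hev l).lintegral_comp (hmeas l)
    simp only [eLpNorm_eq_lintegral_rpow_enorm_toReal hp0 hpt]
    rw [ENNReal.prod_rpow_of_nonneg (by positivity), ← key]
    refine le_of_eq ?_
    congr 1
    refine lintegral_congr fun x => ?_
    rw [enorm_finset_prod, ENNReal.prod_rpow_of_nonneg (by positivity)]

theorem memLp_pi_prod (f : Fin m → Lp 𝕜 p μ) :
    MemLp (fun x : Fin m → X => ∏ l, f l (x l)) p (Measure.pi fun _ => μ) := by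
  refine ⟨?_, (eLpNorm_pi_prod_le f).trans_lt ?_⟩
  · refine (Measurable.stronglyMeasurable ?_).aestronglyMeasurable
    exact Finset.measurable_prod _ fun l _ =>
      (Lp.stronglyMeasurable (f l)).measurable.comp (measurable_pi_apply l)
  · exact ENNReal.prod_lt_top fun l _ => Lp.eLpNorm_lt_top (f l)

/-- The multilinear map `(f₁, …, f_m) ↦ ((x₁, …, x_m) ↦ f₁(x₁) ⋯ f_m(x_m))`. -/
def embedMultilinear (𝕜 : Type*) [RCLike 𝕜] (p : ℝ≥0∞) [Fact (1 ≤ p)] (μ : Measure X)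
    [IsProbabilityMeasure μ] (m : ℕ) :
    ContinuousMultilinearMap 𝕜 (fun _ : Fin m => Lp 𝕜 p μ)
      (Lp 𝕜 p (Measure.pi fun _ : Fin m => μ)) :=
  MultilinearMap.mkContinuous
    { toFun := fun f => (memLp_pi_prod f).toLp _
      map_update_add' := fun {dec} f i a b => by
        rw [← MemLp.toLp_add, MemLp.toLp_eq_toLp_iff]
        have h := (measurePreserving_eval (fun _ : Fin m => μ) i).quasiMeasurePreserving.ae
          (Lp.coeFn_add a b)
        filter_upwards [h] with x hx
        rw [Pi.add_apply]
        rw [← Finset.mul_prod_erase Finset.univ _ (Finset.mem_univ i),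
          ← Finset.mul_prod_erase Finset.univ (fun l => (Function.update f i a l) (x l))
            (Finset.mem_univ i),
          ← Finset.mul_prod_erase Finset.univ (fun l => (Function.update f i b l) (x l))
            (Finset.mem_univ i)]
        have hc : ∀ c : Lp 𝕜 p μ,
            ∏ l ∈ Finset.univ.erase i, (Function.update f i c l) (x l)
              = ∏ l ∈ Finset.univ.erase i, f l (x l) := fun c =>
          Finset.prod_congr rfl fun l hl => by
            rw [Function.update_of_ne (Finset.ne_of_mem_erase hl)]
        simp only [hc, Function.update_self]
        rw [← add_mul]
        congr 1
      map_update_smul' := fun {dec} f i c a => by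
        rw [← MemLp.toLp_const_smul, MemLp.toLp_eq_toLp_iff]
        have h := (measurePreserving_eval (fun _ : Fin m => μ) i).quasiMeasurePreserving.ae
          (Lp.coeFn_smul c a)
        filter_upwards [h] with x hx
        rw [Pi.smul_apply]
        rw [← Finset.mul_prod_erase Finset.univ _ (Finset.mem_univ i),
          ← Finset.mul_prod_erase Finset.univ (fun l => (Function.update f i a l) (x l))
            (Finset.mem_univ i)]
        have hc : ∀ c : Lp 𝕜 p μ,
            ∏ l ∈ Finset.univ.erase i, (Function.update f i c l) (x l)
              = ∏ l ∈ Finset.univ.erase i, f l (x l) := fun c =>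
          Finset.prod_congr rfl fun l hl => by
            rw [Function.update_of_ne (Finset.ne_of_mem_erase hl)]
        simp only [hc, Function.update_self]
        rw [← smul_mul_assoc]
        congr 1 }
    1 fun f => by
      rw [one_mul, MultilinearMap.coe_mk, Lp.norm_toLp]
      calc _ ≤ (∏ l, eLpNorm (f l) p μ).toReal :=
            ENNReal.toReal_mono (ENNReal.prod_lt_top fun l _ => Lp.eLpNorm_lt_top (f l)).ne
              (eLpNorm_pi_prod_le f)
        _ = _ := by simp [ENNReal.toReal_prod, Lp.norm_def]

/-- The linear contraction `J_m : L_{p,π}(μ^m) → L_p(μ^m)` with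
`J_m (f₁ ⊗ ⋯ ⊗ f_m)(x₁, …, x_m) = f₁(x₁) ⋯ f_m(x_m)`. -/
def embed : ProjLp 𝕜 p μ m →L[𝕜] Lp 𝕜 p (Measure.pi fun _ : Fin m => μ) :=
  (PiTensorProduct.liftIsometry 𝕜 _ _ (embedMultilinear 𝕜 p μ m)).fromCompletion

/-- A kernel is canonical if integrating out any one of its variables gives `0`. -/
def IsCanonical (f : ProjLp 𝕜 p μ m) : Prop :=
  ∀ l : Fin m, ∀ᵐ x ∂(Measure.pi fun _ : Fin m => μ),
    ∫ t, embed f (Function.update x l t) ∂μ = 0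

/-! ### Restriction to the diagonal -/

theorem eLpNorm_finset_prod_le {ι : Type*} (s : Finset ι) (f : ι → Lp 𝕜 p μ) :
    eLpNorm (∏ l ∈ s, (f l : X → 𝕜)) (∑ _l ∈ s, p⁻¹)⁻¹ μ ≤ ∏ l ∈ s, eLpNorm (f l) p μ := by
  classical
  induction s using Finset.cons_induction with
  | empty =>
    simp only [Finset.prod_empty, Finset.sum_empty, ENNReal.inv_zero, eLpNorm_exponent_top]
    refine eLpNormEssSup_le_of_ae_enorm_bound ?_
    filter_upwards with x
    simp
  | cons i s hi ih =>
    rw [Finset.prod_cons, Finset.prod_cons]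
    have hs : MemLp (∏ l ∈ s, (f l : X → 𝕜)) (∑ _l ∈ s, p⁻¹)⁻¹ μ :=
      MemLp.prod fun l _ => Lp.memLp (f l)
    have : ENNReal.HolderTriple p (∑ _l ∈ s, p⁻¹)⁻¹ (∑ _l ∈ s.cons i hi, p⁻¹)⁻¹ :=
      ⟨by rw [inv_inv, inv_inv, Finset.sum_cons]⟩
    have h := eLpNorm_smul_le_mul_eLpNorm (p := p) (q := (∑ _l ∈ s, p⁻¹)⁻¹)
      (r := (∑ _l ∈ s.cons i hi, p⁻¹)⁻¹) hs.1
      (Lp.memLp (f i)).1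
    rw [smul_eq_mul] at h
    exact h.trans (by gcongr)

theorem inv_sum_inv_eq_div : (∑ _l : Fin m, p⁻¹)⁻¹ = p / (m : ℝ≥0∞) := by
  have hp0 : p ≠ 0 := (zero_lt_one.trans_le (Fact.out : (1 : ℝ≥0∞) ≤ p)).ne'
  rw [Finset.sum_const, Finset.card_univ, Fintype.card_fin, nsmul_eq_mul,
    ENNReal.mul_inv (Or.inr (by simpa using hp0)) (Or.inl (ENNReal.natCast_ne_top m)), inv_inv,
    mul_comm, ENNReal.div_eq_inv_mul, mul_comm]

theorem eLpNorm_diag_prod_le (f : Fin m → Lp 𝕜 p μ) :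
    eLpNorm (fun x : X => ∏ l, f l x) (p / (m : ℝ≥0∞)) μ ≤ ∏ l, eLpNorm (f l) p μ := by
  have h := eLpNorm_finset_prod_le Finset.univ f
  rw [inv_sum_inv_eq_div] at h
  simpa [Finset.prod_fn] using h

theorem memLp_diag_prod (f : Fin m → Lp 𝕜 p μ) :
    MemLp (fun x : X => ∏ l, f l x) (p / (m : ℝ≥0∞)) μ := by
  have h := MemLp.prod' (s := Finset.univ) (p := fun _ => p) fun l _ => Lp.memLp (f l)
  rwa [inv_sum_inv_eq_div] at h

/-- The multilinear map `(f₁, …, f_m) ↦ f₁ ⋯ f_m` from `L_p(μ)^m` to `L_{p/m}(μ)`. -/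
def diagMultilinear (𝕜 : Type*) [RCLike 𝕜] (p : ℝ≥0∞) [Fact (1 ≤ p)] (μ : Measure X)
    [IsProbabilityMeasure μ] (m : ℕ) [Fact (1 ≤ p / (m : ℝ≥0∞))] :
    ContinuousMultilinearMap 𝕜 (fun _ : Fin m => Lp 𝕜 p μ) (Lp 𝕜 (p / (m : ℝ≥0∞)) μ) :=
  MultilinearMap.mkContinuous
    { toFun := fun f => (memLp_diag_prod f).toLp _
      map_update_add' := fun {dec} f i a b => by
        rw [← MemLp.toLp_add, MemLp.toLp_eq_toLp_iff]
        filter_upwards [Lp.coeFn_add a b] with x hx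
        rw [Pi.add_apply]
        rw [← Finset.mul_prod_erase Finset.univ _ (Finset.mem_univ i),
          ← Finset.mul_prod_erase Finset.univ (fun l => (Function.update f i a l) x)
            (Finset.mem_univ i),
          ← Finset.mul_prod_erase Finset.univ (fun l => (Function.update f i b l) x)
            (Finset.mem_univ i)]
        have hc : ∀ c : Lp 𝕜 p μ,
            ∏ l ∈ Finset.univ.erase i, (Function.update f i c l) x
              = ∏ l ∈ Finset.univ.erase i, f l x := fun c =>
          Finset.prod_congr rfl fun l hl => by
            rw [Function.update_of_ne (Finset.ne_of_mem_erase hl)]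
        simp only [hc, Function.update_self]
        rw [← add_mul]
        congr 1
      map_update_smul' := fun {dec} f i c a => by
        rw [← MemLp.toLp_const_smul, MemLp.toLp_eq_toLp_iff]
        filter_upwards [Lp.coeFn_smul c a] with x hx
        rw [Pi.smul_apply]
        rw [← Finset.mul_prod_erase Finset.univ _ (Finset.mem_univ i),
          ← Finset.mul_prod_erase Finset.univ (fun l => (Function.update f i a l) x)
            (Finset.mem_univ i)]
        have hc : ∀ c : Lp 𝕜 p μ,
            ∏ l ∈ Finset.univ.erase i, (Function.update f i c l) x
              = ∏ l ∈ Finset.univ.erase i, f l x := fun c =>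
          Finset.prod_congr rfl fun l hl => by
            rw [Function.update_of_ne (Finset.ne_of_mem_erase hl)]
        simp only [hc, Function.update_self]
        rw [← smul_mul_assoc]
        congr 1 }
    1 fun f => by
      rw [one_mul, MultilinearMap.coe_mk, Lp.norm_toLp]
      calc _ ≤ (∏ l, eLpNorm (f l) p μ).toReal :=
            ENNReal.toReal_mono (ENNReal.prod_lt_top fun l _ => Lp.eLpNorm_lt_top (f l)).ne
              (eLpNorm_diag_prod_le f)
        _ = _ := by simp [ENNReal.toReal_prod, Lp.norm_def]

/-- For `p ≥ m`, the restriction operator `D_m : L_{p,π}(μ^m) → L_{p/m}(μ)` with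
`D_m (f₁ ⊗ ⋯ ⊗ f_m) = f₁ ⋯ f_m`. -/
def diagRestriction [Fact (1 ≤ p / (m : ℝ≥0∞))] :
    ProjLp 𝕜 p μ m →L[𝕜] Lp 𝕜 (p / (m : ℝ≥0∞)) μ :=
  (PiTensorProduct.liftIsometry 𝕜 _ _ (diagMultilinear 𝕜 p μ m)).fromCompletion

/-! ### Multiparameter sums and the summands of the martingale-coboundary decomposition -/

/-- The multi-indices `k` with `0 ≤ k_l < n_l` for every `l`. -/
def box (n : Fin m → ℕ) : Finset (Fin m → ℕ) :=
  Fintype.piFinset fun l => Finset.range (n l)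

/-- The multi-indices `k` with `0 ≤ k_l < n_l` for `l ∈ S` and `k_l = 0` for `l ∉ S`. -/
def boxOn (S : Finset (Fin m)) (n : Fin m → ℕ) : Finset (Fin m → ℕ) :=
  Fintype.piFinset fun l => if l ∈ S then Finset.range (n l) else {0}

/-- `g = ∑_{0 ≤ k < ∞} V^{*k} f`: the sums over the boxes `0 ≤ k < n` converge to `g` in
`L_{p,π}(μ^m)` as `n₁, …, n_m → ∞` independently. -/
def HasPotential {T : Fin m → X → X} (hT : ∀ l, MeasurePreserving (T l) μ μ)
    (f g : ProjLp 𝕜 p μ m) : Prop :=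
  Tendsto (fun n : Fin m → ℕ => ∑ k ∈ box n, koopmanAdjPow hT k f) atTop (𝓝 g)

/-- `h^S = (∏_{l ∈ S} V^{*e_l}) g`. -/
def potentialPart {T : Fin m → X → X} (hT : ∀ l, MeasurePreserving (T l) μ μ)
    (S : Finset (Fin m)) (g : ProjLp 𝕜 p μ m) : ProjLp 𝕜 p μ m :=
  tensorOp (fun l => if l ∈ S then koopmanAdj 𝕜 p (hT l) else 1) g

/-- `A^S f = (∏_{l ∉ S} (I - V^{e_l} V^{*e_l}) ∏_{l ∈ S} (V^{e_l} - I)) h^S`, as a function of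
`g = ∑ V^{*k} f`. -/
def martCobSummand {T : Fin m → X → X} (hT : ∀ l, MeasurePreserving (T l) μ μ)
    (S : Finset (Fin m)) (g : ProjLp 𝕜 p μ m) : ProjLp 𝕜 p μ m :=
  tensorOp (fun l => if l ∈ S then koopman 𝕜 p (hT l) - 1
    else 1 - koopman 𝕜 p (hT l) * koopmanAdj 𝕜 p (hT l)) (potentialPart hT S g)

end VonMises

end

noncomputable section

namespace VonMises

variable {𝕜 : Type*} [RCLike 𝕜] {X : Type u} [MeasurableSpace X] {μ : Measure X}
  [IsProbabilityMeasure μ] {p : ℝ≥0∞} [Fact (1 ≤ p)] {m : ℕ}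

/-! ### Tensor products of operators -/

/-! Everything reduces to operator norms on a single copy of `Lp`. For the projective norm, a tensor
product of operators is bounded by the product of their norms (`norm_tensorOp_apply_le`), and by
multilinearity a sum over a box of multi-indices is the tensor product of one-parameter sums
(`sum_tensorOp`). Each multiparameter estimate is thus a product of `m` estimates on `L_p`. Since
`D_m` is a contraction, the diagonal versions follow at once.

Two one-parameter facts suffice. The sums `∑_{k<n} V^k (V - 1)` telescope and stay bounded in `n`.
The sums `∑_{k<n} V^k (1 - V V*)` have norm `O(√n)`: if `V* d = 0` and `S_n = ∑_{k<n} V^k d`, then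
`S_{n+1} = V S_n + d`, and `d` is orthogonal to the duality function of `V S_n`. The first-order
term in the expansion of `‖V S_n + d‖^p` therefore vanishes, and the uniform smoothness of `L_p`, `p
≥ 2`, lets `‖S_n‖^p` grow no faster than `n^{p/2}`.

An element of the completed tensor product enters only through operator identities. If `V*^{e_l} f =
0` for `l ∈ S`, then `f` is fixed by the tensor product of the `1 - V_l V_l*`, `l ∈ S`. If `g` is
the potential of `f`, then `f = ⊗ (1 - V_l*) g`, and `1 - V* = (1 - V V*) + (V - 1) V*` splits each
factor into a martingale part and a coboundary part. -/

theorem tensorOp_coe (B : Fin m → (Lp 𝕜 p μ →L[𝕜] Lp 𝕜 p μ)) (x : ⨂[𝕜] _ : Fin m, Lp 𝕜 p μ) :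
    tensorOp B (x : ProjLp 𝕜 p μ m) = ((PiTensorProduct.mapL B x :
      ⨂[𝕜] _ : Fin m, Lp 𝕜 p μ) : ProjLp 𝕜 p μ m) :=
  ContinuousLinearMap.completion_apply_coe _ _

theorem tensorOp_one :
    tensorOp (fun _ => 1 : Fin m → (Lp 𝕜 p μ →L[𝕜] Lp 𝕜 p μ)) = 1 := by
  ext x
  induction x using UniformSpace.Completion.induction_on with
  | hp => exact isClosed_eq (by fun_prop) (by fun_prop)
  | ih x => rw [tensorOp_coe, PiTensorProduct.mapL_one]; rfl

theorem tensorOp_mul (A B : Fin m → (Lp 𝕜 p μ →L[𝕜] Lp 𝕜 p μ)) :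
    tensorOp A * tensorOp B = tensorOp (fun l => A l * B l) := by
  ext x
  induction x using UniformSpace.Completion.induction_on with
  | hp => exact isClosed_eq (by fun_prop) (by fun_prop)
  | ih x =>
    rw [mul_apply_eq_comp, tensorOp_coe, tensorOp_coe, tensorOp_coe,
      PiTensorProduct.mapL_mul]
    rfl

theorem tensorOp_tensorOp (A B : Fin m → (Lp 𝕜 p μ →L[𝕜] Lp 𝕜 p μ)) (x : ProjLp 𝕜 p μ m) :
    tensorOp A (tensorOp B x) = tensorOp (fun l => A l * B l) x := by
  rw [← tensorOp_mul]; rfl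

theorem tensorOp_update_add (B : Fin m → (Lp 𝕜 p μ →L[𝕜] Lp 𝕜 p μ)) (i : Fin m)
    (a b : Lp 𝕜 p μ →L[𝕜] Lp 𝕜 p μ) (x : ProjLp 𝕜 p μ m) :
    tensorOp (Function.update B i (a + b)) x
      = tensorOp (Function.update B i a) x + tensorOp (Function.update B i b) x := by
  induction x using UniformSpace.Completion.induction_on with
  | hp => exact isClosed_eq (by fun_prop) (by fun_prop)
  | ih x =>
    have h := congrArg (fun L : (⨂[𝕜] _ : Fin m, Lp 𝕜 p μ) →L[𝕜] _ => L x)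
      ((PiTensorProduct.mapLMultilinear 𝕜 (fun _ : Fin m => Lp 𝕜 p μ)
        (fun _ => Lp 𝕜 p μ)).map_update_add B i a b)
    simp only [tensorOp_coe, ← UniformSpace.Completion.coe_add]
    exact congrArg _ h

/-- Multilinearity in the tuple of operators, carried to the completion by density. This is what
factors a multiparameter sum into one-parameter sums. -/
theorem sum_tensorOp (s : Fin m → Finset ℕ) (B : Fin m → ℕ → (Lp 𝕜 p μ →L[𝕜] Lp 𝕜 p μ))
    (x : ProjLp 𝕜 p μ m) :
    ∑ k ∈ Fintype.piFinset s, tensorOp (fun l => B l (k l)) x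
      = tensorOp (fun l => ∑ j ∈ s l, B l j) x := by
  induction x using UniformSpace.Completion.induction_on with
  | hp => exact isClosed_eq (by fun_prop) (by fun_prop)
  | ih x =>
    have h := congrArg (fun L : (⨂[𝕜] _ : Fin m, Lp 𝕜 p μ) →L[𝕜] _ => L x)
      ((PiTensorProduct.mapLMultilinear 𝕜 (fun _ : Fin m => Lp 𝕜 p μ)
        (fun _ => Lp 𝕜 p μ)).toMultilinearMap.map_sum_finset (g := B) s)
    simp only [tensorOp_coe]
    simp only [sum_apply] at h
    refine Eq.trans ?_ (congrArg (fun y : ⨂[𝕜] _ : Fin m, Lp 𝕜 p μ =>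
      (y : ProjLp 𝕜 p μ m)) h).symm
    exact (map_sum (UniformSpace.Completion.toComplL (𝕜 := 𝕜)
      (E := ⨂[𝕜] _ : Fin m, Lp 𝕜 p μ)) _ _).symm

theorem norm_tensorOp_apply_le (B : Fin m → (Lp 𝕜 p μ →L[𝕜] Lp 𝕜 p μ)) (x : ProjLp 𝕜 p μ m) :
    ‖tensorOp B x‖ ≤ (∏ l, ‖B l‖) * ‖x‖ := by
  induction x using UniformSpace.Completion.induction_on with
  | hp => exact isClosed_le (by fun_prop) (by fun_prop)
  | ih x =>
    rw [tensorOp_coe, UniformSpace.Completion.norm_coe, UniformSpace.Completion.norm_coe]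
    exact (PiTensorProduct.mapL B).le_of_opNorm_le (PiTensorProduct.opNorm_mapL B) x

theorem norm_tensorOp_apply_le_of_le {B : Fin m → (Lp 𝕜 p μ →L[𝕜] Lp 𝕜 p μ)} {b : Fin m → ℝ}
    (h : ∀ l, ‖B l‖ ≤ b l) (x : ProjLp 𝕜 p μ m) : ‖tensorOp B x‖ ≤ (∏ l, b l) * ‖x‖ := by
  refine (norm_tensorOp_apply_le B x).trans ?_
  gcongr with l
  exact h l

theorem norm_diagRestriction_apply_le [Fact (1 ≤ p / (m : ℝ≥0∞))] (x : ProjLp 𝕜 p μ m) :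
    ‖diagRestriction x‖ ≤ ‖x‖ := by
  induction x using UniformSpace.Completion.induction_on with
  | hp => exact isClosed_le (by fun_prop) (by fun_prop)
  | ih x =>
    rw [diagRestriction, ContinuousLinearMap.fromCompletion_apply_coe,
      UniformSpace.Completion.norm_coe]
    refine (ContinuousLinearMap.le_of_opNorm_le _ (c := 1) ?_ x).trans (one_mul _).le
    rw [LinearIsometryEquiv.norm_map]
    exact MultilinearMap.mkContinuous_norm_le _ zero_le_one _

/-- Linearity and contractivity of `D_m`: every bound in the projective norm passes to the diagonal
with the same constant. -/
theorem norm_sum_diagRestriction_le [Fact (1 ≤ p / (m : ℝ≥0∞))] {ι : Type*} (s : Finset ι)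
    (x : ι → ProjLp 𝕜 p μ m) :
    ‖∑ k ∈ s, diagRestriction (x k)‖ ≤ ‖∑ k ∈ s, x k‖ := by
  rw [← map_sum]
  exact norm_diagRestriction_apply_le _

theorem sum_box_tensorOp (n : Fin m → ℕ) (B : Fin m → (Lp 𝕜 p μ →L[𝕜] Lp 𝕜 p μ))
    (x : ProjLp 𝕜 p μ m) :
    ∑ k ∈ box n, tensorOp (fun l => B l ^ k l) x
      = tensorOp (fun l => ∑ j ∈ Finset.range (n l), B l ^ j) x :=
  sum_tensorOp _ (fun l j => B l ^ j) x

theorem sum_boxOn_tensorOp (S : Finset (Fin m)) (n : Fin m → ℕ)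
    (B : Fin m → (Lp 𝕜 p μ →L[𝕜] Lp 𝕜 p μ)) (x : ProjLp 𝕜 p μ m) :
    ∑ k ∈ boxOn S n, tensorOp (fun l => B l ^ k l) x
      = tensorOp (fun l => if l ∈ S then ∑ j ∈ Finset.range (n l), B l ^ j else 1) x := by
  rw [boxOn, sum_tensorOp _ (fun l j => B l ^ j)]
  congr 2
  ext1 l
  split_ifs <;> simp

/-! ### Recovering a kernel from its potential -/

/-- If the rectangular sums of commuting powers converge, then applying `1 - R_l` in the
coordinates outside `S` to the limit yields the limit of the sums over the coordinates in `S`. -/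
theorem tendsto_tensorOp_sum_of_tendsto_box (R : Fin m → (Lp 𝕜 p μ →L[𝕜] Lp 𝕜 p μ))
    {f g : ProjLp 𝕜 p μ m}
    (h : Tendsto (fun n : Fin m → ℕ =>
      tensorOp (fun l => ∑ j ∈ Finset.range (n l), R l ^ j) f) atTop (𝓝 g))
    (A : Finset (Fin m)) :
    Tendsto (fun n : Fin m → ℕ =>
        tensorOp (fun l => if l ∈ A then 1 else ∑ j ∈ Finset.range (n l), R l ^ j) f) atTop
      (𝓝 (tensorOp (fun l => if l ∈ A then 1 - R l else 1) g)) := by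
  induction A using Finset.induction_on with
  | empty => simpa [tensorOp_one] using h
  | insert i A hi ih =>
    set s : (Fin m → ℕ) → ProjLp 𝕜 p μ m := fun n =>
      tensorOp (fun l => if l ∈ A then 1 else ∑ j ∈ Finset.range (n l), R l ^ j) f with hs
    -- Applying `1 - R_i` to the partial sum leaves `1 - R_i ^ n_i` in coordinate `i`. The unwanted
    -- term with `R_i ^ n_i` is the increment of the partial sums when `n_i` grows by one, so it
    -- tends to `0` by convergence alone; no decay of `R_i ^ n` as an operator is needed.
    have hshift : Tendsto (fun n : Fin m → ℕ => n + Pi.single i 1) atTop atTop :=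
      tendsto_atTop_mono (fun n => le_self_add) tendsto_id
    have h0 : Tendsto (fun n => s (n + Pi.single i 1) - s n) atTop (𝓝 0) := by
      simpa using (ih.comp hshift).sub ih
    have h1 : Tendsto (fun n => tensorOp (Function.update (fun _ => 1) i (1 - R i)) (s n)) atTop
        (𝓝 (tensorOp (Function.update (fun _ => 1) i (1 - R i))
          (tensorOp (fun l => if l ∈ A then 1 - R l else 1) g))) :=
      ((ContinuousLinearMap.continuous _).tendsto _).comp ih
    refine Tendsto.congr (fun n => ?_) (by simpa only [add_zero] using h1.add h0) |>.trans
      (congrArg 𝓝 ?_).le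
    · set B : Fin m → (Lp 𝕜 p μ →L[𝕜] Lp 𝕜 p μ) :=
        fun l => if l ∈ A then 1 else ∑ j ∈ Finset.range (n l), R l ^ j with hB
      have e1 : s (n + Pi.single i 1) = s n + tensorOp (Function.update B i (R i ^ n i)) f := by
        have : (fun l => if l ∈ A then 1
            else ∑ j ∈ Finset.range ((n + Pi.single i 1 : Fin m → ℕ) l), R l ^ j)
            = Function.update B i (B i + R i ^ n i) := by
          ext1 l
          rcases eq_or_ne l i with rfl | hl
          · simp [hB, hi, Finset.sum_range_succ]
          · simp [hB, hl]
        simp only [hs]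
        rw [this, tensorOp_update_add, Function.update_eq_self]
      have e2 : tensorOp (Function.update (fun _ => 1) i (1 - R i)) (s n)
          = tensorOp (Function.update B i (1 - R i ^ n i)) f := by
        simp only [hs]
        rw [tensorOp_tensorOp]
        congr 2
        ext1 l
        rcases eq_or_ne l i with rfl | hl
        · simp [hi, mul_neg_geom_sum]
        · simp [hB, hl]
      rw [e1, e2, add_sub_cancel_left, ← tensorOp_update_add, sub_add_cancel]
      congr 2
      ext1 l
      rcases eq_or_ne l i with rfl | hl
      · simp
      · simp [hB, hl]
    · rw [tensorOp_tensorOp]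
      congr 2
      ext1 l
      rcases eq_or_ne l i with rfl | hl
      · simp [hi]
      · simp [hl]

theorem sum_box_koopmanAdjPow {T : Fin m → X → X} (hT : ∀ l, MeasurePreserving (T l) μ μ)
    (n : Fin m → ℕ) (f : ProjLp 𝕜 p μ m) :
    ∑ k ∈ box n, koopmanAdjPow hT k f
      = tensorOp (fun l => ∑ j ∈ Finset.range (n l), koopmanAdj 𝕜 p (hT l) ^ j) f :=
  sum_box_tensorOp n (fun l => koopmanAdj 𝕜 p (hT l)) f

/-- With all coordinates selected the sequence of partial sums is constantly `f`, so the limit must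
be `f`. This replaces the kernel by its potential at the price of one factor `1 - V_l*` in each
coordinate. -/
theorem HasPotential.eq_tensorOp {T : Fin m → X → X} {hT : ∀ l, MeasurePreserving (T l) μ μ}
    {f g : ProjLp 𝕜 p μ m} (h : HasPotential hT f g) :
    f = tensorOp (fun l => 1 - koopmanAdj 𝕜 p (hT l)) g := by
  have h' := tendsto_tensorOp_sum_of_tendsto_box (fun l => koopmanAdj 𝕜 p (hT l))
    (h.congr fun n => sum_box_koopmanAdjPow hT n f) Finset.univ
  simp only [Finset.mem_univ, if_true, tensorOp_one] at h'
  exact tendsto_nhds_unique tendsto_const_nhds h'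

/-! ### Second-order upper bounds for powers of the norm -/

/-- Convexity: the tangent to `t ^ r` at `t = y` lies below the value at `t = 1`. It is Bernoulli's
inequality at `y⁻¹`, multiplied by `y ^ r`. -/
theorem rpow_le_one_add_mul_rpow_mul {r y : ℝ} (hr : 1 ≤ r) (hy : 0 < y) :
    y ^ r ≤ 1 + r * (y ^ (r - 1) * (y - 1)) := by
  have h := one_add_mul_self_le_rpow_one_add (s := y⁻¹ - 1)
    (by have := inv_pos.2 hy; linarith) hr
  rw [add_sub_cancel, Real.inv_rpow hy.le] at h
  have h2 := mul_le_mul_of_nonneg_left h (Real.rpow_pos_of_pos hy r).le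
  rw [mul_inv_cancel₀ (Real.rpow_pos_of_pos hy r).ne'] at h2
  have h3 : y ^ r = y ^ (r - 1) * y := by
    rw [← Real.rpow_add_one hy.ne', sub_add_cancel]
  have h4 : y ^ r * (1 + r * (y⁻¹ - 1)) = y ^ r - r * (y ^ (r - 1) * (y - 1)) := by
    rw [h3]; field_simp; ring
  linarith

/-- Replacing the exponent `s` by an integer `N ≥ s` can only increase the product, whichever side
of `1` contains `y`; the geometric sum then extracts the second factor `y - 1`. -/
theorem sub_one_mul_rpow_sub_one_le {s y : ℝ} (N : ℕ) (hN : s ≤ N) (hy : 0 < y)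
    (hy4 : y ≤ 4) : (y - 1) * (y ^ s - 1) ≤ N * 4 ^ N * (y - 1) ^ 2 := by
  have h1 : (y - 1) * (y ^ s - 1) ≤ (y - 1) * (y ^ N - 1) := by
    rcases le_total 1 y with h | h
    · have : y ^ s ≤ y ^ N := by
        rw [← Real.rpow_natCast]; exact Real.rpow_le_rpow_of_exponent_le h hN
      exact mul_le_mul_of_nonneg_left (by linarith) (by linarith)
    · have : y ^ N ≤ y ^ s := by
        rw [← Real.rpow_natCast]; exact Real.rpow_le_rpow_of_exponent_ge hy h hN
      exact mul_le_mul_of_nonpos_left (by linarith) (by linarith)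
  have h2 : ∑ i ∈ Finset.range N, y ^ i ≤ N * 4 ^ N := by
    refine (Finset.sum_le_card_nsmul _ _ (4 ^ N) fun i hi => ?_).trans (by simp)
    exact (pow_le_pow_left₀ hy.le hy4 i).trans
      (pow_le_pow_right₀ (by norm_num) (Finset.mem_range.1 hi).le)
  calc _ ≤ _ := h1
    _ = (∑ i ∈ Finset.range N, y ^ i) * (y - 1) ^ 2 := by rw [← geom_sum_mul]; ring
    _ ≤ _ := mul_le_mul_of_nonneg_right h2 (sq_nonneg _)

/-- Only an upper bound is sought, so the unbounded second derivative of `y ^ r` at `0` when `r < 2`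
is harmless. -/
theorem exists_rpow_le_quadratic {r : ℝ} (hr : 1 ≤ r) :
    ∃ C : ℝ, 0 ≤ C ∧ ∀ y : ℝ, 0 ≤ y → y ≤ 4 → y ^ r ≤ 1 + r * (y - 1) + C * (y - 1) ^ 2 := by
  obtain ⟨N, hN⟩ := exists_nat_ge (r - 1)
  -- The summand `r` beyond `r * N * 4 ^ N` is what makes the inequality true at `y = 0`.
  refine ⟨r * (N * 4 ^ N + 1), by positivity, fun y hy hy4 => ?_⟩
  rcases hy.eq_or_lt with rfl | hy
  · rw [Real.zero_rpow (by positivity)]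
    have : 0 ≤ r * (N * 4 ^ N : ℝ) := by positivity
    linarith
  · have h1 := rpow_le_one_add_mul_rpow_mul hr hy
    have h2 := sub_one_mul_rpow_sub_one_le N hN hy hy4
    have h3 := mul_le_mul_of_nonneg_left h2 (by linarith : 0 ≤ r)
    have h4 : 0 ≤ r * (y - 1) ^ 2 := by positivity
    linarith

/-- Uniform smoothness of the scalar function `‖·‖ ^ q` for `q ≥ 2`. -/
theorem exists_norm_add_rpow_le (𝕜 : Type*) [RCLike 𝕜] {q : ℝ} (hq : 2 ≤ q) :
    ∃ C : ℝ, 0 ≤ C ∧ ∀ a b : 𝕜,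
      ‖a + b‖ ^ q ≤ ‖a‖ ^ q + q * (‖a‖ ^ (q - 2) * RCLike.re (star a * b))
        + C * (‖a‖ ^ (q - 2) * ‖b‖ ^ (2 : ℝ) + ‖b‖ ^ q) := by
  obtain ⟨C₀, hC₀, h⟩ := exists_rpow_le_quadratic (r := q / 2) (by linarith)
  -- `q / 2 + 9 * C₀` comes from the expansion when `‖b‖ < ‖a‖`; `2 ^ q + q` comes from the crude
  -- estimate when `‖a‖ ≤ ‖b‖`, where `q` absorbs the first-order term.
  refine ⟨q / 2 + 9 * C₀ + 2 ^ q + q, by positivity, fun a b => ?_⟩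
  have hre : |RCLike.re (star a * b)| ≤ ‖a‖ * ‖b‖ := by
    refine (RCLike.abs_re_le_norm _).trans ?_
    rw [norm_mul, norm_star]
  obtain ⟨hre1, hre2⟩ := abs_le.1 hre
  set c := RCLike.re (star a * b) with hc
  have hsq : ‖a + b‖ ^ 2 = ‖a‖ ^ 2 + 2 * c + ‖b‖ ^ 2 := by
    have := norm_add_sq (𝕜 := 𝕜) a b
    rw [RCLike.inner_apply', ← RCLike.star_def] at this
    exact this
  have ha0 := norm_nonneg a
  have hb0 := norm_nonneg b
  have hP : 0 ≤ ‖a‖ ^ (q - 2) * ‖b‖ ^ (2 : ℝ) := by positivity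
  have hB : 0 ≤ ‖b‖ ^ q := by positivity
  rcases le_or_gt ‖a‖ ‖b‖ with hab | hab
  · have h1 : ‖a + b‖ ^ q ≤ 2 ^ q * ‖b‖ ^ q := by
      rw [← Real.mul_rpow (by norm_num) hb0]
      exact Real.rpow_le_rpow (norm_nonneg _) ((norm_add_le _ _).trans (by linarith))
        (by linarith)
    have h2 : -‖b‖ ^ q ≤ ‖a‖ ^ (q - 2) * c := by
      have e1 : ‖a‖ ^ (q - 2) ≤ ‖b‖ ^ (q - 2) := Real.rpow_le_rpow ha0 hab (by linarith)
      have e2 : |‖a‖ ^ (q - 2) * c| ≤ ‖b‖ ^ (q - 2) * ‖b‖ ^ (2 : ℝ) := by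
        rw [abs_mul, abs_of_nonneg (by positivity)]
        refine mul_le_mul e1 ?_ (abs_nonneg _) (by positivity)
        rw [Real.rpow_two]
        nlinarith
      rw [← Real.rpow_add_of_nonneg hb0 (by linarith) (by norm_num), sub_add_cancel] at e2
      exact (abs_le.1 e2).1
    have h3 : 0 ≤ ‖a‖ ^ q := by positivity
    have h4 := mul_le_mul_of_nonneg_left h2 (by linarith : 0 ≤ q)
    have h5 : 0 ≤ (q / 2 + 9 * C₀) * ‖b‖ ^ q := by positivity
    have h6 : 0 ≤ (q / 2 + 9 * C₀ + 2 ^ q + q) * (‖a‖ ^ (q - 2) * ‖b‖ ^ (2 : ℝ)) := by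
      positivity
    linarith
  -- Expand the power `q / 2` of `y = ‖a + b‖ ^ 2 / ‖a‖ ^ 2`, which is at most `4` here. Squared
  -- norms make `y - 1` polynomial in `c` and `‖b‖`.
  · have ha : 0 < ‖a‖ := hb0.trans_lt hab
    have ha2 : 0 < ‖a‖ ^ 2 := by positivity
    have hy4 : ‖a + b‖ ^ 2 / ‖a‖ ^ 2 ≤ 4 := by
      rw [div_le_iff₀ ha2]
      nlinarith
    have h1 := h (‖a + b‖ ^ 2 / ‖a‖ ^ 2) (by positivity) hy4
    have e0 : ∀ t : ℝ, 0 ≤ t → (t ^ 2) ^ (q / 2) = t ^ q := fun t ht => by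
      rw [← Real.rpow_two, ← Real.rpow_mul ht]; congr 1; ring
    have e1 : ‖a‖ ^ q = ‖a‖ ^ (q - 2) * ‖a‖ ^ 2 := by
      rw [← Real.rpow_two, ← Real.rpow_add ha, sub_add_cancel]
    have e2 : ‖a + b‖ ^ 2 / ‖a‖ ^ 2 - 1 = (2 * c + ‖b‖ ^ 2) / ‖a‖ ^ 2 := by
      rw [hsq]; field_simp; ring
    have e3 : (2 * c + ‖b‖ ^ 2) ^ 2 ≤ 9 * (‖a‖ ^ 2 * ‖b‖ ^ 2) := by
      have : |2 * c + ‖b‖ ^ 2| ≤ 3 * (‖a‖ * ‖b‖) := abs_le.2 ⟨by nlinarith, by nlinarith⟩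
      calc _ = |2 * c + ‖b‖ ^ 2| ^ 2 := (sq_abs _).symm
        _ ≤ (3 * (‖a‖ * ‖b‖)) ^ 2 := pow_le_pow_left₀ (abs_nonneg _) this 2
        _ = _ := by ring
    rw [Real.div_rpow (by positivity) (by positivity), e0 _ (norm_nonneg _), e0 _ ha0, e2,
      div_le_iff₀ (by positivity)] at h1
    have e4 : (1 + q / 2 * ((2 * c + ‖b‖ ^ 2) / ‖a‖ ^ 2)
        + C₀ * ((2 * c + ‖b‖ ^ 2) / ‖a‖ ^ 2) ^ 2) * ‖a‖ ^ q
        = ‖a‖ ^ q + q * (‖a‖ ^ (q - 2) * c) + q / 2 * (‖a‖ ^ (q - 2) * ‖b‖ ^ 2)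
          + C₀ * (‖a‖ ^ (q - 2) * ((2 * c + ‖b‖ ^ 2) ^ 2 / ‖a‖ ^ 2)) := by
      rw [e1]; field_simp; ring
    have e5 : (2 * c + ‖b‖ ^ 2) ^ 2 / ‖a‖ ^ 2 ≤ 9 * ‖b‖ ^ 2 := by
      rw [div_le_iff₀ ha2]; linarith
    have e6 : C₀ * (‖a‖ ^ (q - 2) * ((2 * c + ‖b‖ ^ 2) ^ 2 / ‖a‖ ^ 2))
        ≤ C₀ * (‖a‖ ^ (q - 2) * (9 * ‖b‖ ^ 2)) := by gcongr
    rw [Real.rpow_two] at hP ⊢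
    have h5 : 0 ≤ (2 ^ q + q) * (‖a‖ ^ (q - 2) * ‖b‖ ^ 2) := by positivity
    have h6 : 0 ≤ (q / 2 + 9 * C₀ + 2 ^ q + q) * ‖b‖ ^ q := by positivity
    linarith

/-! ### Uniform smoothness of `L_p` -/

theorem integral_norm_rpow_eq (hp : p ≠ ∞) (f : Lp 𝕜 p μ) :
    ∫ x, ‖f x‖ ^ p.toReal ∂μ = ‖f‖ ^ p.toReal := by
  have hp0 : p ≠ 0 := (zero_lt_one.trans_le (Fact.out : (1 : ℝ≥0∞) ≤ p)).ne'
  have hpr : p.toReal ≠ 0 := (ENNReal.toReal_pos hp0 hp).ne'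
  have h0 : 0 ≤ ∫ x, ‖f x‖ ^ p.toReal ∂μ := integral_nonneg fun _ => by positivity
  rw [Lp.norm_def, (Lp.memLp f).eLpNorm_eq_integral_rpow_norm hp0 hp,
    ENNReal.toReal_ofReal (by positivity), Real.rpow_inv_rpow h0 hpr]

theorem integrable_norm_rpow_toReal (hp : p ≠ ∞) (f : Lp 𝕜 p μ) :
    Integrable (fun x => ‖f x‖ ^ p.toReal) μ :=
  (Lp.memLp f).integrable_norm_rpow
    (zero_lt_one.trans_le (Fact.out : (1 : ℝ≥0∞) ≤ p)).ne' hp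

theorem integrable_norm_rpow_mul (hp : 2 ≤ p) (hpt : p ≠ ∞) (f g : Lp 𝕜 p μ) :
    Integrable (fun x => ‖f x‖ ^ (p.toReal - 2) * ‖g x‖ ^ (2 : ℝ)) μ := by
  have hq : 2 ≤ p.toReal := by simpa using ENNReal.toReal_mono hpt hp
  refine ((integrable_norm_rpow_toReal hpt f).add (integrable_norm_rpow_toReal hpt g)).mono' ?_ ?_
  · exact ((Lp.stronglyMeasurable f).norm.measurable.pow_const _ |>.mul
      ((Lp.stronglyMeasurable g).norm.measurable.pow_const _)).aestronglyMeasurable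
  · refine ae_of_all _ fun x => ?_
    have hM : ‖f x‖ ^ (p.toReal - 2) * ‖g x‖ ^ (2 : ℝ) ≤ (max ‖f x‖ ‖g x‖) ^ p.toReal := by
      calc _ ≤ (max ‖f x‖ ‖g x‖) ^ (p.toReal - 2) * (max ‖f x‖ ‖g x‖) ^ (2 : ℝ) := by
            gcongr ?_ ^ _ * ?_ ^ _
            · exact le_max_left _ _
            · exact le_max_right _ _
        _ = _ := by
          rw [← Real.rpow_add_of_nonneg (by positivity) (by linarith) (by norm_num),
            sub_add_cancel]
    rw [Real.norm_of_nonneg (by positivity)]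
    refine hM.trans ?_
    simp only [Pi.add_apply]
    have h1 : 0 ≤ ‖f x‖ ^ p.toReal := by positivity
    have h2 : 0 ≤ ‖g x‖ ^ p.toReal := by positivity
    rcases max_choice ‖f x‖ ‖g x‖ with h | h <;> rw [h] <;> linarith

/-- Hölder's inequality with weights `(q - 2) / q` and `2 / q`; the weight form also covers `q = 2`,
where the first weight is `0`. -/
theorem integral_norm_rpow_mul_le (hp : 2 ≤ p) (hpt : p ≠ ∞) (f g : Lp 𝕜 p μ) :
    ∫ x, ‖f x‖ ^ (p.toReal - 2) * ‖g x‖ ^ (2 : ℝ) ∂μ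
      ≤ ‖f‖ ^ (p.toReal - 2) * ‖g‖ ^ (2 : ℝ) := by
  have hq : 2 ≤ p.toReal := by simpa using ENNReal.toReal_mono hpt hp
  set q := p.toReal with hqdef
  have hq0 : q ≠ 0 := by positivity
  have hp0 : p ≠ 0 := (zero_lt_one.trans_le (Fact.out : (1 : ℝ≥0∞) ≤ p)).ne'
  have hm : ∀ h : Lp 𝕜 p μ, AEMeasurable (fun x => ‖h x‖ₑ ^ q) μ := fun h =>
    ((Lp.stronglyMeasurable h).enorm.pow_const _).aemeasurable
  have key := ENNReal.lintegral_mul_norm_pow_le (hm f) (hm g) (p := (q - 2) / q) (q := 2 / q)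
    (by apply div_nonneg <;> linarith) (by positivity) (by field_simp; ring)
  have hL : ∀ h : Lp 𝕜 p μ, ∀ t : ℝ, (∫⁻ x, ‖h x‖ₑ ^ q ∂μ) ^ (t / q) = ‖h‖ₑ ^ t := by
    intro h t
    rw [Lp.enorm_def, eLpNorm_eq_lintegral_rpow_enorm_toReal hp0 hpt, ← ENNReal.rpow_mul,
      ← hqdef]
    congr 1; ring
  rw [hL, hL] at key
  rw [integral_eq_lintegral_of_nonneg_ae (ae_of_all _ fun x => by positivity)
    (integrable_norm_rpow_mul hp hpt f g).1]
  have hlhs : ∀ x, ENNReal.ofReal (‖f x‖ ^ (q - 2) * ‖g x‖ ^ (2 : ℝ))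
      = (‖f x‖ₑ ^ q) ^ ((q - 2) / q) * (‖g x‖ₑ ^ q) ^ (2 / q) := by
    intro x
    rw [ENNReal.ofReal_mul (by positivity), ← ENNReal.rpow_mul, ← ENNReal.rpow_mul,
      mul_div_cancel₀ _ hq0, mul_div_cancel₀ _ hq0,
      ← ENNReal.ofReal_rpow_of_nonneg (norm_nonneg _) (by linarith),
      ← ENNReal.ofReal_rpow_of_nonneg (norm_nonneg _) (by norm_num), ofReal_norm, ofReal_norm]
  refine (ENNReal.toReal_mono ?_ ((lintegral_congr hlhs).trans_le key)).trans_eq ?_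
  · exact ENNReal.mul_ne_top (ENNReal.rpow_ne_top_of_nonneg (by linarith) enorm_ne_top)
      (ENNReal.rpow_ne_top_of_nonneg (by norm_num) enorm_ne_top)
  · rw [ENNReal.toReal_mul, ← ENNReal.toReal_rpow, ← ENNReal.toReal_rpow, toReal_enorm,
      toReal_enorm]

/-- The duality function `‖x‖ ^ (p - 2) * conj x` lies in the conjugate space. -/
theorem memLp_dualityFun (hp : 2 ≤ p) (hpt : p ≠ ∞) (f : Lp 𝕜 p μ) :
    MemLp (fun x => ((‖f x‖ ^ (p.toReal - 2) : ℝ) : 𝕜) * star (f x)) (p / (p - 1)) μ := by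
  have hq : 2 ≤ p.toReal := by simpa using ENNReal.toReal_mono hpt hp
  have h := (Lp.memLp f).norm_rpow_div (p - 1)
  refine h.of_le ?_ (ae_of_all _ fun x => ?_)
  · have := (Lp.stronglyMeasurable f).measurable
    exact Measurable.aestronglyMeasurable (by fun_prop)
  · rw [ENNReal.toReal_sub_of_le (one_le_two.trans hp) hpt, ENNReal.toReal_one, norm_mul,
      norm_star, RCLike.norm_ofReal, abs_of_nonneg (by positivity),
      Real.norm_of_nonneg (by positivity)]
    refine le_of_eq ?_
    nth_rewrite 2 [← Real.rpow_one ‖f x‖]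
    rw [← Real.rpow_add_of_nonneg (norm_nonneg _) (by linarith) (by norm_num)]
    congr 1; ring

theorem holderConjugate_div_sub_one (hp : 2 ≤ p) (hpt : p ≠ ∞) :
    ENNReal.HolderConjugate p (p / (p - 1)) := by
  have h1 : (1 : ℝ≥0∞) < p := (by norm_num : (1 : ℝ≥0∞) < 2).trans_le hp
  refine ⟨?_⟩
  rw [ENNReal.inv_div (Or.inl (by finiteness)) (Or.inl (tsub_pos_of_lt h1).ne'),
    inv_one, ← one_div, ← ENNReal.add_div, add_tsub_cancel_of_le h1.le,
    ENNReal.div_self (zero_lt_one.trans h1).ne' hpt]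

/-- Integrate the scalar inequality: the first-order term is the real part of the vanishing pairing,
and Hölder bounds the mixed term. The constant is chosen before the probability space. -/
theorem exists_norm_add_rpow_Lp_le (𝕜 : Type*) [RCLike 𝕜] (hp : 2 ≤ p) (hpt : p ≠ ∞) :
    ∃ C : ℝ, 0 ≤ C ∧ ∀ (X : Type u) [MeasurableSpace X] (μ : Measure X) [IsProbabilityMeasure μ]
      (f g : Lp 𝕜 p μ),
      ∫ x, ((‖f x‖ ^ (p.toReal - 2) : ℝ) : 𝕜) * star (f x) * g x ∂μ = 0 →
      ‖f + g‖ ^ p.toReal ≤ ‖f‖ ^ p.toReal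
        + C * (‖f‖ ^ (p.toReal - 2) * ‖g‖ ^ (2 : ℝ) + ‖g‖ ^ p.toReal) := by
  have hq : 2 ≤ p.toReal := by simpa using ENNReal.toReal_mono hpt hp
  obtain ⟨C, hC, h⟩ := exists_norm_add_rpow_le 𝕜 hq
  refine ⟨C, hC, fun X _ μ _ f g hfg => ?_⟩
  have := holderConjugate_div_sub_one hp hpt
  have hI : Integrable (fun x => ((‖f x‖ ^ (p.toReal - 2) : ℝ) : 𝕜) * star (f x) * g x) μ :=
    (memLp_dualityFun hp hpt f).integrable_mul (Lp.memLp g)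
  have hre : ∀ x, RCLike.re (((‖f x‖ ^ (p.toReal - 2) : ℝ) : 𝕜) * star (f x) * g x)
      = ‖f x‖ ^ (p.toReal - 2) * RCLike.re (star (f x) * g x) := fun x => by
    rw [mul_assoc, RCLike.re_ofReal_mul]
  have hI' : Integrable (fun x => ‖f x‖ ^ (p.toReal - 2) * RCLike.re (star (f x) * g x)) μ := by
    simpa only [hre] using hI.re
  have h0 : ∫ x, ‖f x‖ ^ (p.toReal - 2) * RCLike.re (star (f x) * g x) ∂μ = 0 := by
    have := integral_re hI
    simp only [hre] at this
    rw [this, hfg, map_zero]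
  have hf := integrable_norm_rpow_toReal hpt f
  have hg := integrable_norm_rpow_toReal hpt g
  have hfg2 := integrable_norm_rpow_mul hp hpt f g
  have h1 : Integrable (fun x => ‖f x‖ ^ p.toReal
      + p.toReal * (‖f x‖ ^ (p.toReal - 2) * RCLike.re (star (f x) * g x))) μ :=
    hf.add (hI'.const_mul _)
  have h2 : Integrable (fun x => C * (‖f x‖ ^ (p.toReal - 2) * ‖g x‖ ^ (2 : ℝ)
      + ‖g x‖ ^ p.toReal)) μ := (hfg2.add hg).const_mul _
  rw [← integral_norm_rpow_eq hpt (f + g), ← integral_norm_rpow_eq hpt f]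
  calc ∫ x, ‖(f + g : Lp 𝕜 p μ) x‖ ^ p.toReal ∂μ
      ≤ ∫ x, (‖f x‖ ^ p.toReal
          + p.toReal * (‖f x‖ ^ (p.toReal - 2) * RCLike.re (star (f x) * g x))
          + C * (‖f x‖ ^ (p.toReal - 2) * ‖g x‖ ^ (2 : ℝ) + ‖g x‖ ^ p.toReal)) ∂μ := by
        refine integral_mono_ae (integrable_norm_rpow_toReal hpt (f + g)) (h1.add h2) ?_
        filter_upwards [Lp.coeFn_add f g] with x hx
        rw [hx]
        exact h (f x) (g x)
    _ = ∫ x, ‖f x‖ ^ p.toReal ∂μ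
          + C * (∫ x, ‖f x‖ ^ (p.toReal - 2) * ‖g x‖ ^ (2 : ℝ) ∂μ + ‖g‖ ^ p.toReal) := by
        rw [integral_add h1 h2, integral_add hf (hI'.const_mul _), integral_const_mul, integral_const_mul,
          integral_add hfg2 hg, h0, integral_norm_rpow_eq hpt g, mul_zero, add_zero]
    _ ≤ _ := by
        gcongr
        exact integral_norm_rpow_mul_le hp hpt f g

/-! ### Growth of sums of reversed martingale differences -/

/-- A function annihilated by `V*` is orthogonal to the duality function of any `V f`. -/
theorem integral_dualityFun_koopman_mul_eq_zero (hp : 2 ≤ p) (hpt : p ≠ ∞) {T : X → X}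
    (hT : MeasurePreserving T μ μ) (f d : Lp 𝕜 p μ) (hd : koopmanAdj 𝕜 p hT d = 0) :
    ∫ x, ((‖koopman 𝕜 p hT f x‖ ^ (p.toReal - 2) : ℝ) : 𝕜) * star (koopman 𝕜 p hT f x) * d x ∂μ
      = 0 := by
  have := holderConjugate_div_sub_one hp hpt
  have : Fact (1 ≤ p / (p - 1)) := ⟨ENNReal.HolderConjugate.one_le (p / (p - 1)) p⟩
  -- The duality function of `V f` is `V g`, with `g` that of `f`, because both are computed
  -- pointwise. Hence the pairing with `d` equals `∫ (V* d) g = 0`.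
  set g : Lp 𝕜 (p / (p - 1)) μ := (memLp_dualityFun hp hpt f).toLp _ with hg
  have h := integral_koopmanAdj_mul hT d g
  have h0 : ∫ x, koopmanAdj 𝕜 p hT d x * g x ∂μ = 0 := by
    rw [hd, ← integral_zero X 𝕜 (μ := μ)]
    refine integral_congr_ae ?_
    filter_upwards [Lp.coeFn_zero 𝕜 p μ] with x hx
    rw [hx]; simp
  rw [← h0, h]
  refine integral_congr_ae ?_
  filter_upwards [coeFn_koopman hT f, coeFn_koopman hT g,
    hT.quasiMeasurePreserving.ae_eq_comp (memLp_dualityFun hp hpt f).coeFn_toLp] with x h1 h2 h3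
  rw [h2, ← hg] at *
  rw [h3, h1, mul_comm]
  rfl

/-- `f ∘ T` is already measurable for `T⁻¹ 𝓕`, so conditioning leaves it unchanged. -/
theorem koopmanAdj_mul_koopman {T : X → X} (hT : MeasurePreserving T μ μ) :
    koopmanAdj 𝕜 p hT * koopman 𝕜 p hT = 1 := by
  ext1 f
  apply koopman_injective hT
  apply Lp.ext
  refine (koopman_koopmanAdjFun hT (koopman 𝕜 p hT f)).trans ?_
  refine (condExp_congr_ae (coeFn_koopman hT f)).trans (EventuallyEq.trans ?_
    (coeFn_koopman hT f).symm)
  rw [condExp_of_stronglyMeasurable hT.measurable.comap_le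
    ((Lp.stronglyMeasurable f).comp_measurable (comap_measurable T))]
  exact (hT.integrable_comp (Lp.aestronglyMeasurable f)).2 ((Lp.memLp f).integrable Fact.out)

theorem norm_koopman_le {T : X → X} (hT : MeasurePreserving T μ μ) : ‖koopman 𝕜 p hT‖ ≤ 1 :=
  ContinuousLinearMap.opNorm_le_bound _ zero_le_one fun f => by
    rw [norm_koopman_apply, one_mul]

theorem norm_koopmanAdj_le {T : X → X} (hT : MeasurePreserving T μ μ) :
    ‖koopmanAdj 𝕜 p hT‖ ≤ 1 :=
  LinearMap.mkContinuous_norm_le _ zero_le_one _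

theorem norm_pow_le_one {E : Type*} [NormedAddCommGroup E] [NormedSpace 𝕜 E] {A : E →L[𝕜] E}
    (hA : ‖A‖ ≤ 1) (n : ℕ) : ‖A ^ n‖ ≤ 1 := by
  induction n with
  | zero => exact ContinuousLinearMap.norm_id_le
  | succ n ih =>
    rw [pow_succ]
    exact (norm_mul_le _ _).trans (mul_le_one₀ ih (norm_nonneg _) hA)

theorem norm_sub_le_two {E : Type*} [SeminormedAddCommGroup E] {a b : E} (ha : ‖a‖ ≤ 1)
    (hb : ‖b‖ ≤ 1) : ‖a - b‖ ≤ 2 :=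
  (norm_sub_le a b).trans (by linarith)

/-- The numerical induction step, with `r = p / 2` and `u = (2C + 1) n`. For `u ≥ 1` the increment
is at most `2C u ^ (r - 1)`, which Bernoulli's inequality covers when `u` advances by `2C + 1`. -/
theorem rpow_add_mul_le_rpow {r C u : ℝ} (hr : 1 ≤ r) (hC : 0 ≤ C) (hu : 1 ≤ u) :
    u ^ r + C * (u ^ (r - 1) + 1) ≤ (u + (2 * C + 1)) ^ r := by
  have hu0 : 0 < u := by linarith
  have h1 := one_add_mul_self_le_rpow_one_add (s := (2 * C + 1) / u)
    (by have : 0 ≤ (2 * C + 1) / u := by positivity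
        linarith) hr
  have h2 := mul_le_mul_of_nonneg_left h1 (Real.rpow_pos_of_pos hu0 r).le
  rw [← Real.mul_rpow hu0.le (by positivity),
    (by field_simp : u * (1 + (2 * C + 1) / u) = u + (2 * C + 1))] at h2
  refine le_trans ?_ h2
  have h3 : u ^ r = u ^ (r - 1) * u := by rw [← Real.rpow_add_one hu0.ne', sub_add_cancel]
  have h4 : u ^ r * (1 + r * ((2 * C + 1) / u)) = u ^ r + r * ((2 * C + 1) * u ^ (r - 1)) := by
    rw [h3]; field_simp
  rw [h4]
  have h5 : 1 ≤ u ^ (r - 1) := Real.one_le_rpow hu (by linarith)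
  have h6 : (2 * C + 1) * u ^ (r - 1) ≤ r * ((2 * C + 1) * u ^ (r - 1)) :=
    le_mul_of_one_le_left (by positivity) hr
  have h7 : C * 1 ≤ C * u ^ (r - 1) := mul_le_mul_of_nonneg_left h5 hC
  linarith

/-- Induction on `n` of `‖S_n‖ ^ q ≤ ((2C + 1) n) ^ (q / 2) ‖d‖ ^ q`, with smoothness at `V S_n` in
the direction `d` as the inductive step. -/
theorem exists_norm_sum_koopman_apply_le (𝕜 : Type*) [RCLike 𝕜] (hp : 2 ≤ p) (hpt : p ≠ ∞) :
    ∃ K : ℝ, 0 ≤ K ∧ ∀ (X : Type u) [MeasurableSpace X] (μ : Measure X) [IsProbabilityMeasure μ]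
      (T : X → X) (hT : MeasurePreserving T μ μ) (d : Lp 𝕜 p μ), koopmanAdj 𝕜 p hT d = 0 →
      ∀ n : ℕ, ‖∑ k ∈ Finset.range n, (koopman 𝕜 p hT ^ k) d‖ ≤ K * √(n : ℝ) * ‖d‖ := by
  have hq : 2 ≤ p.toReal := by simpa using ENNReal.toReal_mono hpt hp
  obtain ⟨C, hC, h⟩ := exists_norm_add_rpow_Lp_le 𝕜 hp hpt
  refine ⟨√(2 * C + 1), by positivity, fun X _ μ _ T hT d hd n => ?_⟩
  set q := p.toReal
  set S : ℕ → Lp 𝕜 p μ := fun n => ∑ k ∈ Finset.range n, (koopman 𝕜 p hT ^ k) d with hS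
  -- Splitting off the term `k = 0` puts the old sum in the range of `V`, where the orthogonality to
  -- `d` is available.
  have hsucc : ∀ n, S (n + 1) = koopman 𝕜 p hT (S n) + d := fun n => by
    simp only [hS]
    rw [Finset.sum_range_succ', map_sum]
    simp [pow_succ']
  have hd0 := norm_nonneg d
  rcases Nat.eq_zero_or_pos n with rfl | hn
  · simp
  change ‖S n‖ ≤ _
  induction n, hn using Nat.le_induction with
  | base =>
    simp only [hS]
    have : 1 ≤ √(2 * C + 1) := Real.one_le_sqrt.2 (by linarith)
    simpa using le_mul_of_one_le_left hd0 this
  | succ n hn ih =>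
    have hn1 : (1 : ℝ) ≤ n := by exact_mod_cast hn
    have hu : 1 ≤ (2 * C + 1) * n := by nlinarith
    have hsqrt : ∀ v : ℝ, 0 ≤ v → ∀ t : ℝ, √v ^ t = v ^ (t / 2) := fun v hv t => by
      rw [Real.sqrt_eq_rpow, ← Real.rpow_mul hv]; congr 1; ring
    rw [← Real.sqrt_mul (by positivity)] at ih ⊢
    have h1 := h X μ (koopman 𝕜 p hT (S n)) d
      (integral_dualityFun_koopman_mul_eq_zero hp hpt hT (S n) d hd)
    rw [← hsucc, norm_koopman_apply] at h1
    have h2 : ‖S n‖ ^ q ≤ ((2 * C + 1) * n) ^ (q / 2) * ‖d‖ ^ q := by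
      rw [← hsqrt _ (by positivity), ← Real.mul_rpow (by positivity) hd0]
      exact Real.rpow_le_rpow (norm_nonneg _) ih (by linarith)
    have h3 : ‖S n‖ ^ (q - 2) * ‖d‖ ^ (2 : ℝ)
        ≤ ((2 * C + 1) * n) ^ (q / 2 - 1) * ‖d‖ ^ q := by
      have e1 : ‖d‖ ^ q = ‖d‖ ^ (q - 2) * ‖d‖ ^ (2 : ℝ) := by
        rw [← Real.rpow_add_of_nonneg hd0 (by linarith) (by norm_num), sub_add_cancel]
      have e2 : q / 2 - 1 = (q - 2) / 2 := by ring
      rw [e1, ← mul_assoc, e2, ← hsqrt _ (by positivity), ← Real.mul_rpow (by positivity) hd0]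
      gcongr
    have h4 : ‖S (n + 1)‖ ^ q ≤ (√((2 * C + 1) * ((n + 1 : ℕ) : ℝ)) * ‖d‖) ^ q := by
      rw [Real.mul_rpow (by positivity) hd0, hsqrt _ (by positivity)]
      have e : (2 * C + 1) * ((n + 1 : ℕ) : ℝ) = (2 * C + 1) * n + (2 * C + 1) := by
        push_cast; ring
      rw [e]
      calc _ ≤ _ := h1
        _ ≤ ((2 * C + 1) * n) ^ (q / 2) * ‖d‖ ^ q
            + C * (((2 * C + 1) * n) ^ (q / 2 - 1) * ‖d‖ ^ q + ‖d‖ ^ q) := by gcongr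
        _ = (((2 * C + 1) * n) ^ (q / 2) + C * (((2 * C + 1) * n) ^ (q / 2 - 1) + 1))
            * ‖d‖ ^ q := by ring
        _ ≤ _ := by
          gcongr
          exact rpow_add_mul_le_rpow (by linarith) hC hu
    exact (Real.rpow_le_rpow_iff (norm_nonneg _) (by positivity) (by linarith)).1 h4

/-- The sums `∑_{k < n} V^k (I - V V*)` have operator norm `O(√n)` on `L_p(μ)`, `p ≥ 2`. -/
theorem exists_norm_sum_koopman_mul_le (𝕜 : Type*) [RCLike 𝕜] (hp : 2 ≤ p) (hpt : p ≠ ∞) :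
    ∃ K : ℝ, 1 ≤ K ∧ ∀ (X : Type u) [MeasurableSpace X] (μ : Measure X) [IsProbabilityMeasure μ]
      (T : X → X) (hT : MeasurePreserving T μ μ) (n : ℕ),
      ‖(∑ k ∈ Finset.range n, koopman 𝕜 p hT ^ k)
        * (1 - koopman 𝕜 p hT * koopmanAdj 𝕜 p hT)‖ ≤ K * √(n : ℝ) := by
  obtain ⟨K, hK, h⟩ := exists_norm_sum_koopman_apply_le 𝕜 hp hpt
  refine ⟨K * 2 + 1, by linarith, fun X _ μ _ T hT n => ?_⟩
  refine ContinuousLinearMap.opNorm_le_bound _ (by positivity) fun f => ?_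
  -- Since `V* V = 1`, the operator `1 - V V*` maps into the kernel of `V*`; its norm is at most
  -- `2`, whence the factor `2` in the constant.
  have hd : koopmanAdj 𝕜 p hT ((1 - koopman 𝕜 p hT * koopmanAdj 𝕜 p hT) f) = 0 := by
    change (koopmanAdj 𝕜 p hT * (1 - koopman 𝕜 p hT * koopmanAdj 𝕜 p hT)) f = 0
    rw [mul_sub, ← mul_assoc, koopmanAdj_mul_koopman, mul_one, one_mul, sub_self]
    rfl
  have h1 := h X μ T hT _ hd n
  have h2 : ‖(1 - koopman 𝕜 p hT * koopmanAdj 𝕜 p hT : Lp 𝕜 p μ →L[𝕜] Lp 𝕜 p μ)‖ ≤ 2 :=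
    norm_sub_le_two ContinuousLinearMap.norm_id_le
      ((norm_mul_le _ _).trans
        (mul_le_one₀ (norm_koopman_le hT) (norm_nonneg _) (norm_koopmanAdj_le hT)))
  rw [mul_apply_eq_comp, sum_apply]
  calc _ ≤ _ := h1
    _ ≤ K * √(n : ℝ) * (2 * ‖f‖) := by
      gcongr
      exact ContinuousLinearMap.le_of_opNorm_le _ h2 f
    _ ≤ _ := by
      have : 0 ≤ √(n : ℝ) * ‖f‖ := by positivity
      linarith

/-! ### Multiparameter sums of tensor products -/

theorem sum_box_koopmanPow {T : Fin m → X → X} (hT : ∀ l, MeasurePreserving (T l) μ μ)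
    (n : Fin m → ℕ) (f : ProjLp 𝕜 p μ m) :
    ∑ k ∈ box n, koopmanPow hT k f
      = tensorOp (fun l => ∑ j ∈ Finset.range (n l), koopman 𝕜 p (hT l) ^ j) f :=
  sum_box_tensorOp n (fun l => koopman 𝕜 p (hT l)) f

theorem sum_boxOn_koopmanPow {T : Fin m → X → X} (hT : ∀ l, MeasurePreserving (T l) μ μ)
    (S : Finset (Fin m)) (n : Fin m → ℕ) (f : ProjLp 𝕜 p μ m) :
    ∑ k ∈ boxOn S n, koopmanPow hT k f
      = tensorOp (fun l => if l ∈ S then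
          ∑ j ∈ Finset.range (n l), koopman 𝕜 p (hT l) ^ j else 1) f :=
  sum_boxOn_tensorOp S n (fun l => koopman 𝕜 p (hT l)) f

theorem tensorOp_update_one_sub_apply_eq_self {T : Fin m → X → X}
    (hT : ∀ l, MeasurePreserving (T l) μ μ) {f : ProjLp 𝕜 p μ m} {i : Fin m}
    (hf : koopmanAdjPow hT (Pi.single i 1) f = 0) :
    tensorOp (Function.update (fun _ => 1) i
      (1 - koopman 𝕜 p (hT i) * koopmanAdj 𝕜 p (hT i))) f = f := by
  have h0 : tensorOp (Function.update (fun _ => 1) i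
      (koopman 𝕜 p (hT i) * koopmanAdj 𝕜 p (hT i))) f = 0 := by
    have : tensorOp (Function.update (fun _ => 1) i (koopman 𝕜 p (hT i)))
        (koopmanAdjPow hT (Pi.single i 1) f) = tensorOp (Function.update (fun _ => 1) i
          (koopman 𝕜 p (hT i) * koopmanAdj 𝕜 p (hT i))) f := by
      rw [koopmanAdjPow, tensorOp_tensorOp]
      congr 2
      ext1 l
      rcases eq_or_ne l i with rfl | hl
      · simp
      · simp [hl]
    rw [← this, hf, map_zero]
  have h1 := tensorOp_update_add (fun _ => 1) i
    (1 - koopman 𝕜 p (hT i) * koopmanAdj 𝕜 p (hT i))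
    (koopman 𝕜 p (hT i) * koopmanAdj 𝕜 p (hT i)) f
  rw [sub_add_cancel, h0, add_zero, Function.update_eq_self_iff.2 rfl, tensorOp_one] at h1
  exact h1.symm

/-- Turns the vanishing conditions into invariance under a tensor operator, so that operator norms
apply without decomposing `f` into elementary tensors. -/
theorem tensorOp_ite_one_sub_apply_eq_self {T : Fin m → X → X}
    (hT : ∀ l, MeasurePreserving (T l) μ μ) {f : ProjLp 𝕜 p μ m} (S : Finset (Fin m))
    (hf : ∀ l ∈ S, koopmanAdjPow hT (Pi.single l 1) f = 0) :
    tensorOp (fun l => if l ∈ S then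
      1 - koopman 𝕜 p (hT l) * koopmanAdj 𝕜 p (hT l) else 1) f = f := by
  induction S using Finset.induction_on with
  | empty => simp [tensorOp_one]
  | insert i S hi ih =>
    have h1 := tensorOp_update_one_sub_apply_eq_self hT (hf i (Finset.mem_insert_self i S))
    have h2 := ih fun l hl => hf l (Finset.mem_insert_of_mem hl)
    rw [← h2, tensorOp_tensorOp] at h1
    rw [h2] at h1
    refine Eq.trans ?_ h1
    congr 2
    ext1 l
    rcases eq_or_ne l i with rfl | hl
    · simp [hi]
    · simp [hl]

theorem prod_ite_const_mul (S : Finset (Fin m)) (K : ℝ) (a : Fin m → ℝ) :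
    ∏ l, (if l ∈ S then K * a l else 1) = K ^ S.card * ∏ l ∈ S, a l := by
  rw [Finset.prod_ite_mem, Finset.univ_inter, Finset.prod_mul_distrib, Finset.prod_const]

/-- Growth of multiparameter sums of reversed martingale differences. -/
theorem norm_sum_boxOn_koopmanPow_le {K : ℝ} {T : Fin m → X → X}
    (hT : ∀ l, MeasurePreserving (T l) μ μ) {f : ProjLp 𝕜 p μ m} (S : Finset (Fin m))
    (n : Fin m → ℕ)
    (hK : ∀ l, ‖(∑ k ∈ Finset.range (n l), koopman 𝕜 p (hT l) ^ k)
      * (1 - koopman 𝕜 p (hT l) * koopmanAdj 𝕜 p (hT l))‖ ≤ K * √(n l : ℝ))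
    (hf : ∀ l ∈ S, koopmanAdjPow hT (Pi.single l 1) f = 0) :
    ‖∑ k ∈ boxOn S n, koopmanPow hT k f‖ ≤ K ^ S.card * (∏ l ∈ S, √(n l : ℝ)) * ‖f‖ := by
  rw [sum_boxOn_koopmanPow, ← prod_ite_const_mul]
  nth_rewrite 1 [← tensorOp_ite_one_sub_apply_eq_self hT S hf]
  rw [tensorOp_tensorOp]
  refine norm_tensorOp_apply_le_of_le (fun l => ?_) f
  split_ifs with hl
  · exact hK l
  · rw [one_mul]; exact ContinuousLinearMap.norm_id_le

/-- The coboundary sum telescopes to `A ^ n - 1`, bounded uniformly in `n`. -/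
theorem norm_sum_pow_mul_sub_one_mul_le {E : Type*} [NormedAddCommGroup E] [NormedSpace 𝕜 E]
    {A B : E →L[𝕜] E} (hA : ‖A‖ ≤ 1) (hB : ‖B‖ ≤ 1) (n : ℕ) :
    ‖(∑ k ∈ Finset.range n, A ^ k) * ((A - 1) * B)‖ ≤ 2 := by
  rw [← mul_assoc, geom_sum_mul]
  calc _ ≤ ‖A ^ n - 1‖ * ‖B‖ := norm_mul_le _ _
    _ ≤ 2 * 1 := by
      gcongr
      exact norm_sub_le_two (norm_pow_le_one hA n) ContinuousLinearMap.norm_id_le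
    _ = 2 := mul_one 2

/-- Coordinate by coordinate: a coboundary factor for `l ∈ S` costs `2`, a martingale factor for `l
∉ S` costs `K √n_l`. -/
theorem norm_sum_box_martCobSummand_le {K : ℝ} {T : Fin m → X → X}
    (hT : ∀ l, MeasurePreserving (T l) μ μ) (g : ProjLp 𝕜 p μ m) (S : Finset (Fin m))
    (n : Fin m → ℕ)
    (hK : ∀ l, ‖(∑ k ∈ Finset.range (n l), koopman 𝕜 p (hT l) ^ k)
      * (1 - koopman 𝕜 p (hT l) * koopmanAdj 𝕜 p (hT l))‖ ≤ K * √(n l : ℝ)) :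
    ‖∑ k ∈ box n, koopmanPow hT k (martCobSummand hT S g)‖
      ≤ 2 ^ S.card * K ^ (m - S.card) * (∏ l ∈ Sᶜ, √(n l : ℝ)) * ‖g‖ := by
  have hprod : 2 ^ S.card * K ^ (m - S.card) * (∏ l ∈ Sᶜ, √(n l : ℝ))
      = ∏ l, (if l ∈ S then 2 else K * √(n l : ℝ)) := by
    rw [Finset.prod_ite, Finset.prod_const, Finset.filter_mem_eq_inter, Finset.univ_inter,
      Finset.prod_mul_distrib, Finset.prod_const, Finset.filter_not, Finset.filter_mem_eq_inter,
      Finset.univ_inter, ← Finset.compl_eq_univ_sdiff, Finset.card_compl, Fintype.card_fin,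
      mul_assoc]
  rw [sum_box_koopmanPow, martCobSummand, potentialPart, tensorOp_tensorOp, tensorOp_tensorOp,
    hprod]
  refine norm_tensorOp_apply_le_of_le (fun l => ?_) g
  split_ifs with hl
  · rw [mul_assoc]
    exact norm_sum_pow_mul_sub_one_mul_le (norm_koopman_le _) (norm_koopmanAdj_le _) _
  · rw [mul_one]; exact hK l

theorem two_le_two_mul_sqrt {n : ℕ} (hn : n ≠ 0) : (2 : ℝ) ≤ 2 * √(n : ℝ) := by
  have : 1 ≤ √(n : ℝ) := Real.one_le_sqrt.2 (by exact_mod_cast Nat.one_le_iff_ne_zero.2 hn)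
  linarith

theorem norm_sum_koopman_mul_one_sub_koopmanAdj_le {K : ℝ} {T : X → X}
    (hT : MeasurePreserving T μ μ) (n : ℕ)
    (hK : ‖(∑ k ∈ Finset.range n, koopman 𝕜 p hT ^ k)
      * (1 - koopman 𝕜 p hT * koopmanAdj 𝕜 p hT)‖ ≤ K * √(n : ℝ)) :
    ‖(∑ k ∈ Finset.range n, koopman 𝕜 p hT ^ k) * (1 - koopmanAdj 𝕜 p hT)‖
      ≤ (K + 2) * √(n : ℝ) := by
  -- The bounded coboundary part is absorbed into `2 √n`, which needs `n ≥ 1`; for `n = 0` the sum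
  -- is empty.
  rcases eq_or_ne n 0 with rfl | hn
  · simp
  -- The one-parameter martingale-coboundary decomposition.
  have h1 : (1 - koopmanAdj 𝕜 p hT : Lp 𝕜 p μ →L[𝕜] Lp 𝕜 p μ)
      = (1 - koopman 𝕜 p hT * koopmanAdj 𝕜 p hT)
        + (koopman 𝕜 p hT - 1) * koopmanAdj 𝕜 p hT := by
    rw [sub_mul, one_mul]; abel
  rw [h1, mul_add, add_mul]
  exact (norm_add_le _ _).trans (add_le_add hK
    ((norm_sum_pow_mul_sub_one_mul_le (norm_koopman_le _) (norm_koopmanAdj_le _) _).trans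
      (two_le_two_mul_sqrt hn)))

/-- Here the sum telescopes outright and is bounded by `2`; the weaker form gives both sums of a
kernel the same constant. -/
theorem norm_sum_koopmanAdj_mul_one_sub_le {K : ℝ} (hK : 0 ≤ K) {T : X → X}
    (hT : MeasurePreserving T μ μ) (n : ℕ) :
    ‖(∑ k ∈ Finset.range n, koopmanAdj 𝕜 p hT ^ k) * (1 - koopmanAdj 𝕜 p hT)‖
      ≤ (K + 2) * √(n : ℝ) := by
  rcases eq_or_ne n 0 with rfl | hn
  · simp
  rw [geom_sum_mul_neg]
  refine (norm_sub_le_two ContinuousLinearMap.norm_id_le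
    (norm_pow_le_one (norm_koopmanAdj_le hT) n)).trans ((two_le_two_mul_sqrt hn).trans ?_)
  gcongr
  linarith

theorem norm_tensorOp_mul_apply_le_of_hasPotential {K : ℝ} {T : Fin m → X → X}
    {hT : ∀ l, MeasurePreserving (T l) μ μ} {f g : ProjLp 𝕜 p μ m} (h : HasPotential hT f g)
    (n : Fin m → ℕ) (B : Fin m → (Lp 𝕜 p μ →L[𝕜] Lp 𝕜 p μ))
    (hB : ∀ l, ‖B l * (1 - koopmanAdj 𝕜 p (hT l))‖ ≤ K * √(n l : ℝ)) :
    ‖tensorOp B f‖ ≤ K ^ m * √(∏ l, (n l : ℝ)) * ‖g‖ := by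
  have hprod : K ^ m * √(∏ l, (n l : ℝ)) = ∏ l, (K * √(n l : ℝ)) := by
    rw [Finset.prod_mul_distrib, Finset.prod_const, Finset.card_univ, Fintype.card_fin,
      Real.sqrt_prod _ fun l _ => Nat.cast_nonneg _]
  rw [h.eq_tensorOp, tensorOp_tensorOp, hprod]
  exact norm_tensorOp_apply_le_of_le hB g

end VonMises

end

/-! ### Assembly of the three groups of bounds -/

theorem mainTheorem8 {𝕜 : Type} [RCLike 𝕜] (p : ℝ≥0∞) [Fact (1 ≤ p)] (hp : 2 ≤ p)
    (hp_top : p ≠ ∞) :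
    -- growth bound for multiparameter reversed martingale differences
    (∀ s : ℕ, 1 ≤ s → ∃ C : ℝ, 0 < C ∧
      ∀ (m : ℕ) (X : Type u) [MeasurableSpace X] (μ : Measure X) [IsProbabilityMeasure μ]
        (T : Fin m → X → X) (hT : ∀ l, MeasurePreserving (T l) μ μ)
        (S : Finset (Fin m)) (f : VonMises.ProjLp 𝕜 p μ m), S.card = s →
        (∀ l ∈ S, VonMises.koopmanAdjPow hT (Pi.single l 1) f = 0) →
        ∀ n : Fin m → ℕ,
          ‖∑ k ∈ VonMises.boxOn S n, VonMises.koopmanPow hT k f‖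
            ≤ C * (∏ l ∈ S, √(n l : ℝ)) * ‖f‖ ∧
          ∀ [Fact (1 ≤ p / (m : ℝ≥0∞))],
            ‖∑ k ∈ VonMises.boxOn S n,
                VonMises.diagRestriction (VonMises.koopmanPow hT k f)‖
              ≤ C * (∏ l ∈ S, √(n l : ℝ)) * ‖f‖) ∧
    -- bounds for the summands of the martingale-coboundary decomposition
    (∀ m s : ℕ, 1 ≤ m → s ≤ m → ∃ C : ℝ, 0 < C ∧
      ∀ (X : Type u) [MeasurableSpace X] (μ : Measure X) [IsProbabilityMeasure μ]
        (T : Fin m → X → X) (hT : ∀ l, MeasurePreserving (T l) μ μ)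
        (f g : VonMises.ProjLp 𝕜 p μ m),
        VonMises.IsCanonical f → VonMises.HasPotential hT f g →
        ∀ S : Finset (Fin m), S.card = s → ∀ n : Fin m → ℕ,
          ‖∑ k ∈ VonMises.box n,
              VonMises.koopmanPow hT k (VonMises.martCobSummand hT S g)‖
            ≤ C * (∏ l ∈ Sᶜ, √(n l : ℝ)) * ‖g‖ ∧
          ∀ [Fact (1 ≤ p / (m : ℝ≥0∞))],
            ‖∑ k ∈ VonMises.box n, VonMises.diagRestriction
                (VonMises.koopmanPow hT k (VonMises.martCobSummand hT S g))‖
              ≤ C * (∏ l ∈ Sᶜ, √(n l : ℝ)) * ‖g‖) ∧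
    -- bounds for the canonical kernel itself
    (∀ m : ℕ, 1 ≤ m → ∃ C : ℝ, 0 < C ∧
      ∀ (X : Type u) [MeasurableSpace X] (μ : Measure X) [IsProbabilityMeasure μ]
        (T : Fin m → X → X) (hT : ∀ l, MeasurePreserving (T l) μ μ)
        (f g : VonMises.ProjLp 𝕜 p μ m),
        VonMises.IsCanonical f → VonMises.HasPotential hT f g →
        ∀ n : Fin m → ℕ,
          ‖∑ k ∈ VonMises.box n, VonMises.koopmanPow hT k f‖
            ≤ C * √(∏ l, (n l : ℝ)) * ‖g‖ ∧
          ‖∑ k ∈ VonMises.box n, VonMises.koopmanAdjPow hT k f‖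
            ≤ C * √(∏ l, (n l : ℝ)) * ‖g‖ ∧
          ∀ [Fact (1 ≤ p / (m : ℝ≥0∞))],
            ‖∑ k ∈ VonMises.box n, VonMises.diagRestriction (VonMises.koopmanPow hT k f)‖
              ≤ C * √(∏ l, (n l : ℝ)) * ‖g‖ ∧
            ‖∑ k ∈ VonMises.box n, VonMises.diagRestriction (VonMises.koopmanAdjPow hT k f)‖
              ≤ C * √(∏ l, (n l : ℝ)) * ‖g‖) := by
  obtain ⟨K, hK1, hK⟩ := VonMises.exists_norm_sum_koopman_mul_le.{u} 𝕜 hp hp_top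
  have hK0 : 0 < K := zero_lt_one.trans_le hK1
  -- `K` depends only on `𝕜` and `p`. In the first bound coordinates outside `S` contribute a factor
  -- `1`, so `K ^ s` is independent of `m`; the last constant has one factor `K + 2` per coordinate,
  -- for the martingale and coboundary parts together.
  refine ⟨fun s _ => ⟨K ^ s, by positivity, ?_⟩, fun m s _ _ => ⟨2 ^ s * K ^ (m - s),
    by positivity, ?_⟩, fun m _ => ⟨(K + 2) ^ m, by positivity, ?_⟩⟩
  · rintro m X _ μ _ T hT S f rfl hf n
    have h := VonMises.norm_sum_boxOn_koopmanPow_le hT S n (fun l => hK X μ (T l) (hT l) (n l)) hf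
    exact ⟨h, (VonMises.norm_sum_diagRestriction_le _ _).trans h⟩
  · rintro X _ μ _ T hT f g - - S rfl n
    have h := VonMises.norm_sum_box_martCobSummand_le hT g S n
      (fun l => hK X μ (T l) (hT l) (n l))
    exact ⟨h, (VonMises.norm_sum_diagRestriction_le _ _).trans h⟩
  · intro X _ μ _ T hT f g _ hfg n
    have h1 : ‖∑ k ∈ VonMises.box n, VonMises.koopmanPow hT k f‖
        ≤ (K + 2) ^ m * √(∏ l, (n l : ℝ)) * ‖g‖ := by
      rw [VonMises.sum_box_koopmanPow]
      exact VonMises.norm_tensorOp_mul_apply_le_of_hasPotential hfg n _ fun l =>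
        VonMises.norm_sum_koopman_mul_one_sub_koopmanAdj_le (hT l) (n l)
          (hK X μ (T l) (hT l) (n l))
    have h2 : ‖∑ k ∈ VonMises.box n, VonMises.koopmanAdjPow hT k f‖
        ≤ (K + 2) ^ m * √(∏ l, (n l : ℝ)) * ‖g‖ := by
      rw [VonMises.sum_box_koopmanAdjPow]
      exact VonMises.norm_tensorOp_mul_apply_le_of_hasPotential hfg n _ fun l =>
        VonMises.norm_sum_koopmanAdj_mul_one_sub_le hK0.le (hT l) (n l)
    exact ⟨h1, h2, (VonMises.norm_sum_diagRestriction_le _ _).trans h1,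
      (VonMises.norm_sum_diagRestriction_le _ _).trans h2⟩
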